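/- **Setting.** A spin system is a probability measure $\mu$ on $\mathcal Y=\mathcal X^{\mathcal I}$ with finite sets $\mathcal X$ (spins) and $\mathcal I$ (sites). For $x\in\mathcal Y$, $i\in\mathcal I$ write $\overline x_i=(x_j)_{j\neq i}$, let $\overline\mu_i$ be the marginal of $\mu$ on $\mathcal X^{\mathcal I\setminus\{i\}}$, and let $\mu(\cdot\mid\overline x_i)$ be the conditional distribution of the $i$-th spin. For $f:\mathcal Y\to\mathbb R$ put $$\partial_i f(x)^2=\tfrac12\iint\big(f(\overline x_i,y)-f(\overline x_i,y')\big)^2\,d\mu(y\mid\overline x_i)\,d\mu(y'\mid\overline x_i)\quad\text{if }\overline\mu_i(\overline x_i)>0,$$ and $\partial_i f(x)^2=0$ otherwise. We say that $\mu$ satisfies a $\partial$-LSI$(\sigma^2)$ if for all $f:\mathcal Y\to\mathbb R$ $$\operatorname{Ent}_\mu(f^2)\le 2\sigma^2\int\sum_{i\in\mathcal I}(\partial_i f)^2\,d\mu,\qquad \operatorname{Ent}_\mu(g)=\mathbb E_\mu[g\log g]-\mathbb E_\mu g\,\log\mathbb E_\mu g\quad(g\ge0,\ 0\log 0=0).$$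 The Gibbs measure of $H:\mathcal Y\to\mathbb R$ is $\mu(x)=Z^{-1}e^{H(x)}$, $Z=\sum_{x}e^{H(x)}$. **Theorem.** In each of the following cases there is a constant $\sigma^2\in(0,\infty)$, depending only on the parameters named, such that the spin system is a well-defined probability measure and satisfies a $\partial$-LSI$(\sigma^2)$. 1. (Exponential random graph model.) Let $s\ge0$, $\beta\in\mathbb R^s$, and let $G_1,\dots,G_s$ be finite simple connected graphs, $G_i=(V_i,E_i)$. For $n\in\mathbb N$ let $\mathcal I_n=\{(i,j)\in\{1,\dots,n\}^2:i<j\}$, identify $x\in\{0,1\}^{\mathcal I_n}$ with a graph on $\{1,\dots,n\}$, let $N_{G_i}(x)$ be the number of injective edge-preserving maps from $V_i$ to $\{1,\dots,n\}$, and let $\mu_\beta$ be the Gibbs measure on $\{0,1\}^{\mathcal I_n}$ of $$H_\beta(x)=n^2\sum_{i=1}^s\beta_i\frac{N_{G_i}(x)}{n^{|V_i|}}.$$ If $\tfrac12\Phi'_{|\beta|}(1)<1$, where $\Phi_{|\beta|}(x)=\sum_{i=1}^s|\beta_i||E_i|x^{|E_i|-1}$, then the claim holds for all $n$ with $\sigma^2=\sigma^2(\beta,G_1,\dots,G_s)$.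 2. (Vertex-weighted exponential random graph model.) Let $\beta_1,\beta_2\in\mathbb R$, $p\in(0,1)$, and for $n\in\mathbb N$ let $\mu$ be the Gibbs measure on $\{0,1\}^n$ of $$H(x)=\log\Big(\frac p{1-p}\Big)\sum_i x_i+\frac{\beta_1}{n}\sum_{i\ne j}x_ix_j+\frac{\beta_2}{n^2}\sum_{i,j,k\text{ distinct}}x_ix_jx_k,$$ the sums running over ordered pairs and ordered triples. Let $$\phi_\beta(x)=\frac{e^{h_\beta(x)}}{1+e^{h_\beta(x)}},\qquad h_\beta(x)=2\beta_1x+3\beta_2x^2+\log\Big(\frac p{1-p}\Big).$$ If $\sup_{x\in(0,1)}|\phi_\beta'(x)|<1$, then the claim holds for all $n$ with $\sigma^2=\sigma^2(\beta_1,\beta_2,p)$. 3. (Random coloring model.) Let $\Delta,k\in\mathbb N$ (with $0\in\mathbb N$) and $k\ge2\Delta+1$. The claim holds with $\sigma^2=\sigma^2(\Delta,k)$ for the uniform distribution on the set of proper $k$-colorings, as a measure on $\{1,\dots,k\}^V$, for every finite simple graph $G=(V,E)$ of maximum degree at most $\Delta$; in particular, with one constant along every sequence $(G_n)_n$ of such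 graphs. 4. (Hard-core model.) Let $\Delta\in\mathbb N$ (with $0\in\mathbb N$) and $\lambda\ge0$ with $\lambda(\Delta-1)<1$ (i.e. $\lambda<\frac1{\Delta-1}$ if $\Delta\ge2$, and no condition if $\Delta\le1$). The claim holds with $\sigma^2=\sigma^2(\Delta,\lambda)$ for the measure on $\{0,1\}^V$ given by $\mu(x)=Z^{-1}\prod_{v\in V}\lambda^{x_v}$ if $x_vx_w=0$ for all $\{v,w\}\in E$, and $\mu(x)=0$ otherwise ($Z$ is the normalizing constant and $0^0=1$), for every finite simple graph $G=(V,E)$ of maximum degree at most $\Delta$; in particular, with one constant along every sequence $(G_n)_n$ of such graphs. -/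

import Mathlib

/-! Finite spin systems are represented by their probability mass functions
`μ : (ι → X) → ℝ`, where `ι` is the finite set of sites and `X` the finite set of spins. -/

noncomputable section

section General

variable {ι X : Type*} [Fintype ι] [DecidableEq ι] [Fintype X]

/-- `μ` is (the mass function of) a probability measure on `X^ι`. -/
def IsSpinSystem (μ : (ι → X) → ℝ) : Prop :=
  (∀ x, 0 ≤ μ x) ∧ ∑ x, μ x = 1

/-- The expectation `E_μ f`. -/
def expect (μ : (ι → X) → ℝ) (f : (ι → X) → ℝ) : ℝ :=
  ∑ x, μ x * f x

/-- The entropy functional `Ent_μ(f) = E_μ (f log f) - E_μ f log (E_μ f)` for `f ≥ 0`,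
with `0 log 0 = 0`. -/
def entropy (μ : (ι → X) → ℝ) (f : (ι → X) → ℝ) : ℝ :=
  expect μ (fun x => f x * Real.log (f x)) - expect μ f * Real.log (expect μ f)

/-- The mass that the marginal of `μ` on the sites other than `i` gives to `(x_j)_{j ≠ i}`. -/
def marginal (μ : (ι → X) → ℝ) (i : ι) (x : ι → X) : ℝ :=
  ∑ y, μ (Function.update x i y)

/-- The conditional probability of the spin `y` at the site `i`, given `(x_j)_{j ≠ i}`
(meaningful where the marginal is positive). -/
def condProb (μ : (ι → X) → ℝ) (i : ι) (x : ι → X) (y : X) : ℝ :=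
  μ (Function.update x i y) / marginal μ i x

open scoped Classical in
/-- The squared local difference `(∂_i f(x))^2`, i.e. the local variance in the site `i`. -/
def localVariance (μ : (ι → X) → ℝ) (f : (ι → X) → ℝ) (i : ι) (x : ι → X) : ℝ :=
  if 0 < marginal μ i x then
    1 / 2 * ∑ y, ∑ y', (f (Function.update x i y) - f (Function.update x i y')) ^ 2
      * condProb μ i x y * condProb μ i x y'
  else 0

/-- `μ` is a spin system that satisfies a `∂`-LSI with constant `σ2` (the number `σ²`):
`Ent_μ(f²) ≤ 2 σ² ∫ ∑_i (∂_i f)² dμ` for all real functions `f`. -/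
def SatisfiesLSI (μ : (ι → X) → ℝ) (σ2 : ℝ) : Prop :=
  IsSpinSystem μ ∧
    ∀ f : (ι → X) → ℝ,
      entropy μ (fun x => f x ^ 2) ≤ 2 * σ2 * expect μ (fun x => ∑ i, localVariance μ f i x)

/-- The probability mass function proportional to the weight `w`. -/
def normalized (w : (ι → X) → ℝ) (x : ι → X) : ℝ :=
  w x / ∑ y, w y

/-- The Gibbs measure of the Hamiltonian `H`. -/
def gibbs (H : (ι → X) → ℝ) : (ι → X) → ℝ :=
  normalized (fun x => Real.exp (H x))

end General

/-! ### The exponential random graph model -/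

/-- The potential edges `i < j` of a graph with vertices labelled by `Fin n`. -/
abbrev EdgeSite (n : ℕ) : Type := {e : Fin n × Fin n // e.1 < e.2}

/-- The simple graph whose edges are the sites with spin `1`. -/
def graphOf {n : ℕ} (x : EdgeSite n → Fin 2) : SimpleGraph (Fin n) :=
  SimpleGraph.fromRel (fun i j => ∃ h : i < j, x ⟨(i, j), h⟩ = 1)

/-- The number of injective edge preserving maps from `G₁` to `G₂`. -/
def homCount {V W : Type*} (G₁ : SimpleGraph V) (G₂ : SimpleGraph W) : ℕ :=
  Nat.card {φ : V → W // Function.Injective φ ∧ ∀ a b, G₁.Adj a b → G₂.Adj (φ a) (φ b)}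

/-- The Hamiltonian `n² ∑_i β_i N_{G_i}(x) / n^{|V_i|}`. -/
def ergmHamiltonian {s : ℕ} {v : Fin s → ℕ} (G : (i : Fin s) → SimpleGraph (Fin (v i)))
    (β : Fin s → ℝ) (n : ℕ) (x : EdgeSite n → Fin 2) : ℝ :=
  (n : ℝ) ^ 2 * ∑ i, β i * ((homCount (G i) (graphOf x) : ℝ) / (n : ℝ) ^ v i)

/-- The exponential random graph model with parameters `(β, G_1, …, G_s)` on `n` vertices. -/
def ergm {s : ℕ} {v : Fin s → ℕ} (G : (i : Fin s) → SimpleGraph (Fin (v i)))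
    (β : Fin s → ℝ) (n : ℕ) : (EdgeSite n → Fin 2) → ℝ :=
  gibbs (ergmHamiltonian G β n)

/-- `Φ_β(x) = ∑_i β_i |E_i| x^{|E_i| - 1}`; a summand with `|E_i| = 0` vanishes. -/
def ergmPhi {s : ℕ} {v : Fin s → ℕ} (G : (i : Fin s) → SimpleGraph (Fin (v i)))
    (β : Fin s → ℝ) (x : ℝ) : ℝ :=
  ∑ i, β i * (Nat.card (G i).edgeSet : ℝ) * x ^ (Nat.card (G i).edgeSet - 1)

/-! ### The vertex-weighted exponential random graph model -/

/-- The Hamiltonian of the vertex-weighted model; the sums run over ordered pairs and ordered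
triples of pairwise distinct vertices. -/
def vertexHamiltonian (β₁ β₂ p : ℝ) (n : ℕ) (x : Fin n → Fin 2) : ℝ :=
  Real.log (p / (1 - p)) * ∑ i, ((x i).val : ℝ)
    + β₁ / n * ∑ i, ∑ j, (if i ≠ j then ((x i).val : ℝ) * (x j).val else 0)
    + β₂ / (n : ℝ) ^ 2 * ∑ i, ∑ j, ∑ k,
        (if i ≠ j ∧ j ≠ k ∧ i ≠ k then ((x i).val : ℝ) * (x j).val * (x k).val else 0)

/-- The vertex-weighted exponential random graph model on `n` vertices. -/
def vertexERGM (β₁ β₂ p : ℝ) (n : ℕ) : (Fin n → Fin 2) → ℝ :=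
  gibbs (vertexHamiltonian β₁ β₂ p n)

/-- The limiting increment `h_β(x) = 2 β₁ x + 3 β₂ x² + log (p / (1 - p))` of the Hamiltonian
when the spin of one vertex is switched on and a fraction `x` of the other spins is on. -/
def vertexH (β₁ β₂ p : ℝ) (x : ℝ) : ℝ :=
  2 * β₁ * x + 3 * β₂ * x ^ 2 + Real.log (p / (1 - p))

/-- `φ_β = exp h_β / (1 + exp h_β)`. -/
def vertexPhi (β₁ β₂ p : ℝ) (x : ℝ) : ℝ :=
  Real.exp (vertexH β₁ β₂ p x) / (1 + Real.exp (vertexH β₁ β₂ p x))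

/-! ### The random coloring model -/

/-- The set of proper colorings of `G` with `k` colors. -/
def properColorings {V : Type*} (G : SimpleGraph V) (k : ℕ) : Set (V → Fin k) :=
  {σ | ∀ a b, G.Adj a b → σ a ≠ σ b}

/-- The uniform distribution on the set of proper colorings with `k` colors. -/
def randomColoring {V : Type*} (G : SimpleGraph V) (k : ℕ) : (V → Fin k) → ℝ :=
  (properColorings G k).indicator (fun _ => 1 / ((properColorings G k).ncard : ℝ))

/-! ### The hard-core model -/

/-- The admissible configurations: no two adjacent sites are occupied. -/
def admissible {V : Type*} (G : SimpleGraph V) : Set (V → Fin 2) :=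
  {σ | ∀ a b, G.Adj a b → (σ a).val * (σ b).val = 0}

/-- The hard-core model on `G` with fugacity `lam`. -/
def hardCore {V : Type*} [Fintype V] [DecidableEq V] (G : SimpleGraph V) (lam : ℝ) :
    (V → Fin 2) → ℝ :=
  normalized ((admissible G).indicator (fun σ => ∏ a, lam ^ (σ a).val))

end

/-! ### Heat-bath kernels and Dobrushin's comparison vector -/

section HeatBath

variable {ι X : Type*} [Fintype ι] [DecidableEq ι] [Fintype X]

/-! All four cases reduce to one criterion, `satisfiesLSI_of_influence`. Suppose the single-site
kernels have an influence matrix with row and column sums at most α < 1, and every single-spin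
probability, under every pinning, is zero or at least β. Then the inequality holds with σ² = 2 / (β
(1 - α)²), whatever the number of sites.

The kernels `K` are defined on all configurations, so conditioning on a spin changes neither them
nor α and β; only the set S of free sites shrinks. This allows induction on |S|. Let g² have mean 1
under μ, put ν = g² μ, and let V be the sum of the site forms V_i over S. Averaging the chain rule
`entropy_eq_sum_pin` over i ∈ S writes |S| Ent as the mean entropies after pinning i plus the
relative entropies of the one-site marginals of ν and μ. Pinning i removes V_i, so by induction the
first sum is at most C (|S| - 1) V. It remains to bound the second by C V
(`sum_marginal_entropy_le`): the bound β turns relative entropy into squared total variation,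
Dobrushin's comparison bounds the total variations by a vector with a ≤ b + A a, hence |a|² ≤ |b|² /
(1 - α)², and Cauchy–Schwarz gives b_i² ≤ V_i.

For hard constraints the influence is computed at each edge, and β comes from resampling the
neighbors of a site. For the Gibbs models the kernel is a sigmoid of the increment of the
Hamiltonian; its Lipschitz constant 1/4 gives the condition of the exponential random graph model.
In the vertex-weighted model the slope of φ_β governs all large n, and the finitely many small n are
handled by comparison with the uniform measure. -/

/-- A family of single-site resampling kernels: `K i x` is a probability vector on the spins that
does not depend on the spin of `x` at `i`. -/
structure IsSiteKernel (K : ι → (ι → X) → X → ℝ) : Prop where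
  nonneg : ∀ i x y, 0 ≤ K i x y
  sum_eq_one : ∀ i x, ∑ y, K i x y = 1
  update_eq : ∀ i x y, K i (Function.update x i y) = K i x

/-- Detailed balance of `μ` for the kernels at the sites in `S`. -/
def DetailedBalance (K : ι → (ι → X) → X → ℝ) (S : Finset ι) (μ : (ι → X) → ℝ) : Prop :=
  ∀ i ∈ S, ∀ x y, μ x * K i x y = μ (Function.update x i y) * K i x (x i)

/-- The configuration is deterministic outside of `S` under `μ`. -/
def IsPinnedOff (S : Finset ι) (μ : (ι → X) → ℝ) : Prop :=
  ∃ z : ι → X, ∀ x, μ x ≠ 0 → ∀ i ∉ S, x i = z i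

/-- The Dirichlet form (without factor `1/2`) of the resampling of the site `i`. -/
noncomputable def siteForm (K : ι → (ι → X) → X → ℝ) (μ : (ι → X) → ℝ) (i : ι)
    (g : (ι → X) → ℝ) : ℝ :=
  ∑ x, ∑ y, μ x * K i x y * (g x - g (Function.update x i y)) ^ 2

/-- Resampling the site `i`. -/
noncomputable def resample (K : ι → (ι → X) → X → ℝ) (i : ι) (f : (ι → X) → ℝ) (x : ι → X) : ℝ :=
  ∑ y, K i x y * f (Function.update x i y)

/-- The mass of the configurations with spin `y` at `i`. -/
noncomputable def siteMass [DecidableEq X] (μ : (ι → X) → ℝ) (i : ι) (y : X) : ℝ :=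
  ∑ x, if x i = y then μ x else 0

/-- The measure `μ` conditioned on the spin `y` at `i`. -/
noncomputable def pin [DecidableEq X] (μ : (ι → X) → ℝ) (i : ι) (y : X) (x : ι → X) : ℝ :=
  (if x i = y then μ x else 0) / siteMass μ i y

variable {K : ι → (ι → X) → X → ℝ} {S : Finset ι} {μ : (ι → X) → ℝ}

lemma sum_update_swap (i : ι) (F : (ι → X) → X → ℝ) :
    ∑ x, ∑ y, F x y = ∑ x : ι → X, ∑ y, F (Function.update x i y) (x i) := by
  rw [← Fintype.sum_prod_type', ← Fintype.sum_prod_type']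
  refine Fintype.sum_bijective (fun p : (ι → X) × X => (Function.update p.1 i p.2, p.1 i)) ?_ _ _ ?_
  · refine Function.Involutive.bijective fun p => ?_
    simp
  · intro p
    simp

/-- Under detailed balance the pair formed by a configuration and its resampling at `i` is
exchangeable. -/
lemma IsSiteKernel.swap (hK : IsSiteKernel K) (hμ : DetailedBalance K S μ) {i : ι} (hi : i ∈ S)
    (F : (ι → X) → (ι → X) → ℝ) :
    ∑ x, ∑ y, μ x * K i x y * F x (Function.update x i y)
      = ∑ x, ∑ y, μ x * K i x y * F (Function.update x i y) x := by
  rw [sum_update_swap i]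
  refine Finset.sum_congr rfl fun x _ => Finset.sum_congr rfl fun y _ => ?_
  rw [hK.update_eq, Function.update_idem, Function.update_eq_self, hμ i hi x y]

lemma IsSiteKernel.sum_mul_kernel (hK : IsSiteKernel K) (i : ι) (f : (ι → X) → ℝ) :
    ∑ x, ∑ y, μ x * K i x y * f x = expect μ f := by
  refine Finset.sum_congr rfl fun x _ => ?_
  rw [← Finset.sum_mul, ← Finset.mul_sum, hK.sum_eq_one, mul_one]

lemma sum_mul_kernel_update (i : ι) (f : (ι → X) → ℝ) :
    ∑ x, ∑ y, μ x * K i x y * f (Function.update x i y) = expect μ (resample K i f) := by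
  refine Finset.sum_congr rfl fun x _ => ?_
  rw [resample, Finset.mul_sum]
  exact Finset.sum_congr rfl fun y _ => by ring

lemma IsSiteKernel.expect_resample (hK : IsSiteKernel K) (hμ : DetailedBalance K S μ) {i : ι}
    (hi : i ∈ S) (f : (ι → X) → ℝ) : expect μ (resample K i f) = expect μ f := by
  rw [← sum_mul_kernel_update, hK.swap hμ hi (fun _ y => f y), hK.sum_mul_kernel]

omit [Fintype ι] in
lemma IsSiteKernel.marginal_mul (hK : IsSiteKernel K) (hμ : DetailedBalance K S μ) {i : ι}
    (hi : i ∈ S) (x : ι → X) (y : X) :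
    marginal μ i x * K i x y = μ (Function.update x i y) := by
  rw [marginal, Finset.sum_mul]
  have : ∀ y', μ (Function.update x i y') * K i x y = μ (Function.update x i y) * K i x y' := by
    intro y'
    have := hμ i hi (Function.update x i y') y
    simpa [hK.update_eq] using this
  simp_rw [this]
  rw [← Finset.mul_sum, hK.sum_eq_one, mul_one]

/-- By invariance the site may be resampled once more, which produces two independent draws from the
conditional law. Configurations of mass zero drop out, so the default value of `localVariance` plays
no role. -/
lemma IsSiteKernel.siteForm_eq (hK : IsSiteKernel K) (hμ : DetailedBalance K S μ)
    (h0 : ∀ x, 0 ≤ μ x) {i : ι} (hi : i ∈ S) (g : (ι → X) → ℝ) :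
    siteForm K μ i g = 2 * expect μ (localVariance μ g i) := by
  have h1 : siteForm K μ i g
      = expect μ (fun x => ∑ y, K i x y * (g x - g (Function.update x i y)) ^ 2) := by
    refine Finset.sum_congr rfl fun x _ => ?_
    rw [Finset.mul_sum]
    exact Finset.sum_congr rfl fun y _ => by ring
  rw [h1, ← hK.expect_resample hμ hi, expect, expect, Finset.mul_sum]
  refine Finset.sum_congr rfl fun x _ => ?_
  rcases (h0 x).eq_or_lt with hx | hx
  · simp [← hx]
  have hm : 0 < marginal μ i x := by
    refine Finset.sum_pos' (fun y _ => h0 _) ⟨x i, Finset.mem_univ _, ?_⟩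
    simpa using hx
  have hc : ∀ y, condProb μ i x y = K i x y := by
    intro y
    rw [condProb, ← hK.marginal_mul hμ hi, mul_div_cancel_left₀ _ hm.ne']
  rw [mul_left_comm, localVariance, if_pos hm, resample]
  congr 1
  rw [← mul_assoc, mul_one_div_cancel two_ne_zero, one_mul]
  refine Finset.sum_congr rfl fun y _ => ?_
  rw [Finset.mul_sum]
  refine Finset.sum_congr rfl fun y' _ => ?_
  rw [hc, hc, hK.update_eq, Function.update_idem]
  ring

lemma siteForm_nonneg (hK : IsSiteKernel K) (h0 : ∀ x, 0 ≤ μ x) (i : ι) (g : (ι → X) → ℝ) :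
    0 ≤ siteForm K μ i g :=
  Finset.sum_nonneg fun x _ => Finset.sum_nonneg fun y _ =>
    mul_nonneg (mul_nonneg (h0 x) (hK.nonneg i x y)) (sq_nonneg _)

/-- Since `u - v` has total mass zero, `f` may be replaced by `f - min f` or `max f - f`, both with
values in `[0, D]`; then only the positive part of `u - v` matters. -/
lemma abs_sum_mul_le_of_posPart [Nonempty X] {u v f : X → ℝ} {A D : ℝ}
    (hu : ∑ y, u y = ∑ y, v y) (hA : ∑ y, max (u y - v y) 0 ≤ A)
    (hD : ∀ y y', f y - f y' ≤ D) : |∑ y, (u y - v y) * f y| ≤ A * D := by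
  have hD0 : 0 ≤ D := by simpa using hD (Classical.arbitrary X) (Classical.arbitrary X)
  have key : ∀ w : X → ℝ, (∀ y, 0 ≤ w y) → (∀ y, w y ≤ D) → ∑ y, (u y - v y) * w y ≤ A * D := by
    intro w hw hwD
    calc ∑ y, (u y - v y) * w y ≤ ∑ y, max (u y - v y) 0 * D := by
          refine Finset.sum_le_sum fun y _ => ?_
          exact (mul_le_mul_of_nonneg_right (le_max_left _ _) (hw y)).trans
            (mul_le_mul_of_nonneg_left (hwD y) (le_max_right _ _))
      _ ≤ A * D := by
          rw [← Finset.sum_mul]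
          exact mul_le_mul_of_nonneg_right hA hD0
  have hshift : ∀ c : ℝ, ∑ y, (u y - v y) * c = 0 := by
    intro c
    rw [← Finset.sum_mul, Finset.sum_sub_distrib, hu, sub_self, zero_mul]
  obtain ⟨y0, h0⟩ := Finite.exists_min f
  obtain ⟨y1, h1⟩ := Finite.exists_max f
  rw [abs_le]
  constructor
  · have := key (fun y => f y1 - f y) (fun y => sub_nonneg.2 (h1 y)) (fun y => hD _ _)
    simp only [mul_sub, Finset.sum_sub_distrib] at this
    have h2 := hshift (f y1)
    linarith
  · have := key (fun y => f y - f y0) (fun y => sub_nonneg.2 (h0 y)) (fun y => hD _ _)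
    simp only [mul_sub, Finset.sum_sub_distrib] at this
    have h2 := hshift (f y0)
    linarith

/-- `δ i` bounds the oscillation of `h` in the coordinate `i`. -/
def HasOsc (h : (ι → X) → ℝ) (δ : ι → ℝ) : Prop :=
  ∀ i x y, |h (Function.update x i y) - h x| ≤ δ i

omit [Fintype ι] [Fintype X] in
lemma HasOsc.nonneg [Nonempty X] {h : (ι → X) → ℝ} {δ : ι → ℝ} (hδ : HasOsc h δ) (i : ι) :
    0 ≤ δ i :=
  (abs_nonneg _).trans (hδ i (fun _ => Classical.arbitrary X) (Classical.arbitrary X))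

omit [Fintype ι] [Fintype X] in
lemma HasOsc.abs_sub_le {h : (ι → X) → ℝ} {δ : ι → ℝ} (hδ : HasOsc h δ) (S : Finset ι) :
    ∀ x x' : ι → X, (∀ i ∉ S, x i = x' i) → |h x - h x'| ≤ ∑ i ∈ S, δ i := by
  induction S using Finset.induction_on with
  | empty =>
    intro x x' hx
    rw [funext fun i => hx i (Finset.notMem_empty i)]
    simp
  | insert i S hi ih =>
    intro x x' hx
    rw [Finset.sum_insert hi]
    have h1 := hδ i x (x' i)
    have h2 := ih (Function.update x i (x' i)) x' (by
      intro j hj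
      by_cases hji : j = i
      · subst hji; simp
      · rw [Function.update_of_ne hji]
        exact hx j (by simp [hji, hj]))
    rw [abs_sub_comm] at h1
    exact (_root_.abs_sub_le _ _ _).trans (add_le_add h1 h2)

/-- `A` bounds the total variation influence of the spin at `j` on the kernel at `i`. -/
def HasInfluence (K : ι → (ι → X) → X → ℝ) (A : ι → ι → ℝ) : Prop :=
  ∀ i j x c, ∑ y, max (K i (Function.update x j c) y - K i x y) 0 ≤ A i j

omit [Fintype ι] in
lemma HasInfluence.nonneg [Nonempty X] {A : ι → ι → ℝ} (hA : HasInfluence K A) (i j : ι) :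
    0 ≤ A i j :=
  (Finset.sum_nonneg fun _ _ => le_max_right _ _).trans
    (hA i j (fun _ => Classical.arbitrary X) (Classical.arbitrary X))

-- Resampling `i` erases the dependence on the spin at `i`. A change at `j` then acts directly
-- through `h`, and indirectly through the law of the new spin at `i`.
omit [Fintype ι] in
lemma hasOsc_resample [Nonempty X] (hK : IsSiteKernel K) {A : ι → ι → ℝ} (hA : HasInfluence K A)
    {h : (ι → X) → ℝ} {δ : ι → ℝ} (hδ : HasOsc h δ) (i : ι) :
    HasOsc (resample K i h) (fun j => if j = i then 0 else δ j + A i j * δ i) := by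
  intro j x c
  by_cases hj : j = i
  · subst hj
    simp [resample, hK.update_eq]
  simp only [if_neg hj]
  have hdec : resample K i h (Function.update x j c) - resample K i h x
      = ∑ y, K i x y * (h (Function.update (Function.update x j c) i y)
          - h (Function.update x i y))
        + ∑ y, (K i (Function.update x j c) y - K i x y)
          * h (Function.update (Function.update x j c) i y) := by
    rw [resample, resample, ← Finset.sum_sub_distrib, ← Finset.sum_add_distrib]
    exact Finset.sum_congr rfl fun y _ => by ring
  rw [hdec]
  refine (abs_add_le _ _).trans (add_le_add ?_ ?_)
  · calc _ ≤ ∑ y, K i x y * δ j := by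
          refine (Finset.abs_sum_le_sum_abs _ _).trans (Finset.sum_le_sum fun y _ => ?_)
          rw [abs_mul, abs_of_nonneg (hK.nonneg _ _ _), Function.update_comm hj]
          exact mul_le_mul_of_nonneg_left (hδ _ _ _) (hK.nonneg _ _ _)
      _ = δ j := by rw [← Finset.sum_mul, hK.sum_eq_one, one_mul]
  · refine abs_sum_mul_le_of_posPart (by rw [hK.sum_eq_one, hK.sum_eq_one]) (hA i j x c) ?_
    intro y y'
    have := hδ i (Function.update (Function.update x j c) i y') y
    rw [Function.update_idem] at this
    exact (le_abs_self _).trans this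

omit [Fintype ι] in
/-- Dobrushin's comparison: a functional on observables that changes little under resampling is
controlled by a minimal vector of weights. -/
lemma exists_minimal_estimate [Nonempty X] (hK : IsSiteKernel K) {A : ι → ι → ℝ}
    (hA : HasInfluence K A) (L : ((ι → X) → ℝ) → ℝ) (b : ι → ℝ) (hb : ∀ i, 0 ≤ b i)
    (h1 : ∀ h δ, HasOsc h δ → |L h| ≤ ∑ i ∈ S, δ i)
    (h2 : ∀ i ∈ S, ∀ h δ, HasOsc h δ → |L h| ≤ b i * δ i + |L (resample K i h)|) :
    ∃ a : ι → ℝ, (∀ i, 0 ≤ a i) ∧ (∀ h δ, HasOsc h δ → |L h| ≤ ∑ i ∈ S, a i * δ i) ∧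
      ∀ i ∈ S, a i ≤ b i + ∑ j ∈ S, A i j * a j := by
  let E : Set (ι → ℝ) := {a | ∀ h δ, HasOsc h δ → |L h| ≤ ∑ i ∈ S, a i * δ i}
  have hE : IsClosed E := by
    have : E = ⋂ h, ⋂ δ, ⋂ (_ : HasOsc h δ), {a | |L h| ≤ ∑ i ∈ S, a i * δ i} := by
      ext a; simp [E]
    rw [this]
    refine isClosed_iInter fun h => isClosed_iInter fun δ => isClosed_iInter fun _ => ?_
    exact isClosed_le continuous_const (by fun_prop)
  -- The vector `a` minimizes its sum over `S` among all valid weights in the unit cube; the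
  -- constant vector 1 is valid by `h1`.
  have hc : IsCompact (Set.Icc (0 : ι → ℝ) 1 ∩ E) := isCompact_Icc.inter_right hE
  have hne : (Set.Icc (0 : ι → ℝ) 1 ∩ E).Nonempty :=
    ⟨1, ⟨fun _ => zero_le_one, le_rfl⟩, fun h δ hδ => by simpa using h1 h δ hδ⟩
  obtain ⟨a, ⟨ha1, haE⟩, hmin⟩ := hc.exists_isMinOn hne
    (f := fun a => ∑ i ∈ S, a i) (by fun_prop)
  refine ⟨a, ha1.1, haE, fun i hi => ?_⟩
  by_contra! hlt
  set r := b i + ∑ j ∈ S, A i j * a j with hr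
  have hr0 : 0 ≤ r := add_nonneg (hb i)
    (Finset.sum_nonneg fun j _ => mul_nonneg (hA.nonneg i j) (ha1.1 j))
  -- If `a i` exceeded `r`, it could be lowered to `r`: apply the current estimate to `resample K i
  -- h` and pay `b i * δ i` for the resampling. This contradicts minimality.
  have hmem : Function.update a i r ∈ Set.Icc (0 : ι → ℝ) 1 ∩ E := by
    refine ⟨⟨fun j => ?_, fun j => ?_⟩, fun h δ hδ => ?_⟩
    · by_cases hj : j = i
      · subst hj; simpa using hr0
      · simpa [hj] using ha1.1 j
    · by_cases hj : j = i
      · subst hj; simpa using hlt.le.trans (ha1.2 j)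
      · simpa [hj] using ha1.2 j
    · have h3 := haE _ _ (hasOsc_resample hK hA hδ i)
      have h4 := h2 i hi h δ hδ
      have h5 : ∑ j ∈ S, a j * (if j = i then 0 else δ j + A i j * δ i)
          ≤ ∑ j ∈ S.erase i, a j * δ j + (∑ j ∈ S, A i j * a j) * δ i := by
        rw [Finset.sum_mul, ← Finset.add_sum_erase S _ hi, ← Finset.add_sum_erase S (fun j =>
          A i j * a j * δ i) hi, if_pos rfl, mul_zero, zero_add]
        have h6 : 0 ≤ A i i * a i * δ i :=
          mul_nonneg (mul_nonneg (hA.nonneg i i) (ha1.1 i)) (hδ.nonneg i)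
        have h7 : ∑ j ∈ S.erase i, a j * (if j = i then 0 else δ j + A i j * δ i)
            = ∑ j ∈ S.erase i, a j * δ j + ∑ j ∈ S.erase i, A i j * a j * δ i := by
          rw [← Finset.sum_add_distrib]
          refine Finset.sum_congr rfl fun j hj => ?_
          rw [if_neg (Finset.ne_of_mem_erase hj)]
          ring
        linarith
      have h8 : ∑ j ∈ S, Function.update a i r j * δ j
          = r * δ i + ∑ j ∈ S.erase i, a j * δ j := by
        rw [← Finset.add_sum_erase S _ hi, Function.update_self]
        congr 1
        refine Finset.sum_congr rfl fun j hj => ?_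
        rw [Function.update_of_ne (Finset.ne_of_mem_erase hj)]
      rw [h8, hr, add_mul]
      linarith
  have h9 := hmin hmem
  simp only [Set.mem_ofPred_eq] at h9
  rw [← Finset.add_sum_erase S _ hi, ← Finset.add_sum_erase S (fun j => Function.update a i r j) hi,
    Function.update_self] at h9
  have h10 : ∑ j ∈ S.erase i, Function.update a i r j = ∑ j ∈ S.erase i, a j :=
    Finset.sum_congr rfl fun j hj => Function.update_of_ne (Finset.ne_of_mem_erase hj) _ _
  linarith

-- A Schur test: multiply the hypothesis by `a i` and use `2 a_i a_j ≤ a_i² + a_j²`. The row and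
-- column bounds give `(1 - α) ∑ a² ≤ ∑ a b`, and a second such inequality finishes.
omit [Fintype ι] [DecidableEq ι] in
lemma sum_sq_le_of_le_add_sum {A : ι → ι → ℝ} {a b : ι → ℝ} {α : ℝ} (hα : α < 1)
    (hA : ∀ i j, 0 ≤ A i j) (ha : ∀ i, 0 ≤ a i)
    (hrow : ∀ i ∈ S, ∑ j ∈ S, A i j ≤ α) (hcol : ∀ j ∈ S, ∑ i ∈ S, A i j ≤ α)
    (h : ∀ i ∈ S, a i ≤ b i + ∑ j ∈ S, A i j * a j) :
    (1 - α) ^ 2 * ∑ i ∈ S, a i ^ 2 ≤ ∑ i ∈ S, b i ^ 2 := by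
  have h1 : ∑ i ∈ S, a i ^ 2 ≤ ∑ i ∈ S, a i * b i + α * ∑ i ∈ S, a i ^ 2 := by
    calc ∑ i ∈ S, a i ^ 2 ≤ ∑ i ∈ S, (a i * b i + ∑ j ∈ S, A i j * ((a i ^ 2 + a j ^ 2) / 2)) := by
          refine Finset.sum_le_sum fun i hi => ?_
          have h3 : ∑ j ∈ S, a i * (A i j * a j) ≤ ∑ j ∈ S, A i j * ((a i ^ 2 + a j ^ 2) / 2) :=
            Finset.sum_le_sum fun j _ => by
              rw [mul_left_comm]
              exact mul_le_mul_of_nonneg_left (by nlinarith [sq_nonneg (a i - a j)]) (hA i j)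
          have h4 := mul_le_mul_of_nonneg_left (h i hi) (ha i)
          rw [mul_add, Finset.mul_sum] at h4
          nlinarith
      _ = ∑ i ∈ S, a i * b i + (∑ i ∈ S, (∑ j ∈ S, A i j) * a i ^ 2
            + ∑ j ∈ S, (∑ i ∈ S, A i j) * a j ^ 2) / 2 := by
          rw [Finset.sum_add_distrib]
          congr 1
          simp_rw [Finset.sum_mul]
          rw [Finset.sum_comm (f := fun j i => A i j * a j ^ 2), ← Finset.sum_add_distrib,
            Finset.sum_div]
          refine Finset.sum_congr rfl fun i _ => ?_
          rw [← Finset.sum_add_distrib, Finset.sum_div]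
          exact Finset.sum_congr rfl fun j _ => by ring
      _ ≤ _ := by
          have h5 : ∑ i ∈ S, (∑ j ∈ S, A i j) * a i ^ 2 ≤ α * ∑ i ∈ S, a i ^ 2 := by
            rw [Finset.mul_sum]
            exact Finset.sum_le_sum fun i hi =>
              mul_le_mul_of_nonneg_right (hrow i hi) (sq_nonneg _)
          have h6 : ∑ i ∈ S, (∑ j ∈ S, A j i) * a i ^ 2 ≤ α * ∑ i ∈ S, a i ^ 2 := by
            rw [Finset.mul_sum]
            exact Finset.sum_le_sum fun i hi =>
              mul_le_mul_of_nonneg_right (hcol i hi) (sq_nonneg _)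
          linarith
  have h2 : 2 * (1 - α) * ∑ i ∈ S, a i * b i
      ≤ (1 - α) ^ 2 * ∑ i ∈ S, a i ^ 2 + ∑ i ∈ S, b i ^ 2 := by
    rw [Finset.mul_sum, Finset.mul_sum, ← Finset.sum_add_distrib]
    exact Finset.sum_le_sum fun i _ => by nlinarith [sq_nonneg ((1 - α) * a i - b i)]
  nlinarith [mul_le_mul_of_nonneg_left h1 (by linarith : 0 ≤ 2 * (1 - α))]

end HeatBath

/-! ### Comparison of g² μ with μ, pinning, and the chain rule for entropy -/

section DobrushinLSI

variable {ι X : Type*} [Fintype ι] [DecidableEq ι] [Fintype X]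
variable {K : ι → (ι → X) → X → ℝ} {S : Finset ι} {μ : (ι → X) → ℝ}

/-- The total variation between resampled and original squares, controlled by the site form. -/
noncomputable def squareForm (K : ι → (ι → X) → X → ℝ) (μ : (ι → X) → ℝ) (i : ι)
    (g : (ι → X) → ℝ) : ℝ :=
  1 / 2 * ∑ x, ∑ y, μ x * K i x y * |g x ^ 2 - g (Function.update x i y) ^ 2|

lemma IsSiteKernel.squareForm_nonneg (hK : IsSiteKernel K) (h0 : ∀ x, 0 ≤ μ x) (i : ι)
    (g : (ι → X) → ℝ) : 0 ≤ squareForm K μ i g :=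
  mul_nonneg (by norm_num) <| Finset.sum_nonneg fun x _ => Finset.sum_nonneg fun y _ =>
    mul_nonneg (mul_nonneg (h0 x) (hK.nonneg i x y)) (abs_nonneg _)

/-- Cauchy–Schwarz for `g² - g'² = (g - g') (g + g')`. Both copies have second moment 1, so the
second factor is at most 4, which cancels the square of the prefactor 1/2. -/
lemma IsSiteKernel.squareForm_sq_le (hK : IsSiteKernel K) (hμ : DetailedBalance K S μ)
    (h0 : ∀ x, 0 ≤ μ x) {i : ι} (hi : i ∈ S) {g : (ι → X) → ℝ}
    (hg : expect μ (fun x => g x ^ 2) = 1) : squareForm K μ i g ^ 2 ≤ siteForm K μ i g := by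
  have hw : ∀ x y, 0 ≤ μ x * K i x y := fun x y => mul_nonneg (h0 x) (hK.nonneg i x y)
  have hplus : ∑ x, ∑ y, μ x * K i x y * (g x + g (Function.update x i y)) ^ 2 ≤ 4 := by
    calc _ ≤ ∑ x, ∑ y, (2 * (μ x * K i x y * g x ^ 2)
          + 2 * (μ x * K i x y * g (Function.update x i y) ^ 2)) := by
          refine Finset.sum_le_sum fun x _ => Finset.sum_le_sum fun y _ => ?_
          nlinarith [mul_nonneg (hw x y) (sq_nonneg (g x - g (Function.update x i y)))]
      _ = 4 := by
          simp_rw [Finset.sum_add_distrib, ← Finset.mul_sum]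
          rw [hK.swap hμ hi (fun _ y => g y ^ 2), hK.sum_mul_kernel i (fun x => g x ^ 2), hg]
          norm_num
  have hcs : (∑ x, ∑ y, μ x * K i x y * |g x ^ 2 - g (Function.update x i y) ^ 2|) ^ 2
      ≤ siteForm K μ i g * ∑ x, ∑ y, μ x * K i x y * (g x + g (Function.update x i y)) ^ 2 := by
    rw [siteForm, ← Fintype.sum_prod_type', ← Fintype.sum_prod_type', ← Fintype.sum_prod_type']
    refine Finset.sum_sq_le_sum_mul_sum_of_sq_le_mul _ (fun p _ => ?_) (fun p _ => ?_)
      (fun p _ => ?_)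
    · exact mul_nonneg (hw _ _) (sq_nonneg _)
    · exact mul_nonneg (hw _ _) (sq_nonneg _)
    · rw [mul_pow, sq_abs]
      exact le_of_eq (by ring)
  have h2 := mul_le_mul_of_nonneg_left hplus (siteForm_nonneg hK h0 i g)
  rw [squareForm, mul_pow]
  linarith

/-- By exchangeability the difference is half the integral of `(g² - g'²) (h - h')`, and `|h - h'| ≤
δ i`. -/
lemma IsSiteKernel.abs_expect_sq_mul_sub (hK : IsSiteKernel K) (hμ : DetailedBalance K S μ)
    (h0 : ∀ x, 0 ≤ μ x) {i : ι} (hi : i ∈ S) (g : (ι → X) → ℝ) {h : (ι → X) → ℝ} {δ : ι → ℝ}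
    (hδ : HasOsc h δ) :
    |expect μ (fun x => g x ^ 2 * h x) - expect μ (fun x => g x ^ 2 * resample K i h x)|
      ≤ squareForm K μ i g * δ i := by
  have h1 : expect μ (fun x => g x ^ 2 * h x) - expect μ (fun x => g x ^ 2 * resample K i h x)
      = ∑ x, ∑ y, μ x * K i x y * (g x ^ 2 * (h x - h (Function.update x i y))) := by
    rw [← hK.sum_mul_kernel i]
    simp_rw [mul_sub, Finset.sum_sub_distrib]
    congr 1
    refine Finset.sum_congr rfl fun x _ => ?_
    simp only [resample]
    rw [Finset.mul_sum, Finset.mul_sum]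
    exact Finset.sum_congr rfl fun y _ => by ring
  have h2 := hK.swap hμ hi (fun x x' => g x ^ 2 * (h x - h x'))
  have h3 : expect μ (fun x => g x ^ 2 * h x) - expect μ (fun x => g x ^ 2 * resample K i h x)
      = 1 / 2 * ∑ x, ∑ y, μ x * K i x y * ((g x ^ 2 - g (Function.update x i y) ^ 2)
          * (h x - h (Function.update x i y))) := by
    have h4 : ∑ x, ∑ y, μ x * K i x y * ((g x ^ 2 - g (Function.update x i y) ^ 2)
          * (h x - h (Function.update x i y)))
        = ∑ x, ∑ y, μ x * K i x y * (g x ^ 2 * (h x - h (Function.update x i y)))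
          + ∑ x, ∑ y, μ x * K i x y * (g (Function.update x i y) ^ 2
            * (h (Function.update x i y) - h x)) := by
      simp_rw [← Finset.sum_add_distrib]
      exact Finset.sum_congr rfl fun x _ => Finset.sum_congr rfl fun y _ => by ring
    rw [h4, ← h2, h1]
    ring
  rw [h3, squareForm, mul_assoc, abs_mul, abs_of_pos (by norm_num : (0 : ℝ) < 1 / 2)]
  refine mul_le_mul_of_nonneg_left ?_ (by norm_num)
  rw [Finset.sum_mul]
  refine (Finset.abs_sum_le_sum_abs _ _).trans (Finset.sum_le_sum fun x _ => ?_)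
  rw [Finset.sum_mul]
  refine (Finset.abs_sum_le_sum_abs _ _).trans (Finset.sum_le_sum fun y _ => ?_)
  rw [abs_mul, abs_of_nonneg (mul_nonneg (h0 x) (hK.nonneg i x y)), abs_mul, ← mul_assoc]
  refine mul_le_mul_of_nonneg_left ?_
    (mul_nonneg (mul_nonneg (h0 x) (hK.nonneg i x y)) (abs_nonneg _))
  rw [abs_sub_comm]
  exact hδ i x y

/-- Couple the two measures independently: both configurations agree outside `S`. This crude
estimate starts the minimization in `exists_minimal_estimate`. -/
lemma abs_expect_mul_sub_le (hμ : IsSpinSystem μ) (hp : IsPinnedOff S μ) {f : (ι → X) → ℝ}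
    (hf : ∀ x, 0 ≤ f x) (hf1 : expect μ f = 1) {h : (ι → X) → ℝ} {δ : ι → ℝ} (hδ : HasOsc h δ) :
    |expect μ (fun x => f x * h x) - expect μ h| ≤ ∑ i ∈ S, δ i := by
  obtain ⟨z, hz⟩ := hp
  have h1 : expect μ (fun x => f x * h x) - expect μ h
      = ∑ x, ∑ x', μ x * f x * μ x' * (h x - h x') := by
    simp_rw [mul_sub, Finset.sum_sub_distrib]
    congr 1
    · refine Finset.sum_congr rfl fun x _ => ?_
      rw [← Finset.sum_mul, ← Finset.mul_sum, hμ.2]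
      ring
    · rw [Finset.sum_comm]
      refine Finset.sum_congr rfl fun x' _ => ?_
      rw [← Finset.sum_mul, ← Finset.sum_mul]
      change _ = expect μ f * _ * _
      rw [hf1, one_mul]
  have h2 : ∑ i ∈ S, δ i = ∑ x, ∑ x', μ x * f x * μ x' * ∑ i ∈ S, δ i := by
    simp_rw [← Finset.sum_mul, ← Finset.mul_sum, hμ.2, mul_one]
    change _ = expect μ f * _
    rw [hf1, one_mul]
  rw [h1, h2]
  refine (Finset.abs_sum_le_sum_abs _ _).trans (Finset.sum_le_sum fun x _ => ?_)
  refine (Finset.abs_sum_le_sum_abs _ _).trans (Finset.sum_le_sum fun x' _ => ?_)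
  have h3 : 0 ≤ μ x * f x * μ x' := mul_nonneg (mul_nonneg (hμ.1 x) (hf x)) (hμ.1 x')
  rw [abs_mul, abs_of_nonneg h3]
  by_cases hx : μ x = 0
  · simp [hx]
  by_cases hx' : μ x' = 0
  · simp [hx']
  exact mul_le_mul_of_nonneg_left
    (hδ.abs_sub_le S x x' fun i hi => (hz x hx i hi).trans (hz x' hx' i hi).symm) h3

variable [DecidableEq X]

lemma sum_eq_sum_siteMass (i : ι) (F : (ι → X) → ℝ) :
    ∑ x, F x = ∑ y, ∑ x : ι → X, if x i = y then F x else 0 := by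
  rw [Finset.sum_comm]
  exact Finset.sum_congr rfl fun x _ => by simp

/-- The test function is the sign of the difference of the marginals at the spin of `i`; it has
oscillation 2 at `i` and 0 elsewhere. -/
lemma sum_abs_siteMass_sub_le {ν : (ι → X) → ℝ} {a : ι → ℝ}
    (h : ∀ h δ, HasOsc h δ → |∑ x, (ν x - μ x) * h x| ≤ ∑ i ∈ S, a i * δ i) {i : ι} (hi : i ∈ S) :
    ∑ y, |siteMass ν i y - siteMass μ i y| ≤ 2 * a i := by
  let s : X → ℝ := fun y => if 0 ≤ siteMass ν i y - siteMass μ i y then 1 else -1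
  have hs : HasOsc (fun x : ι → X => s (x i)) (fun j => if j = i then 2 else 0) := by
    intro j x y
    by_cases hj : j = i
    · subst hj
      simp only [if_true, Function.update_self, s]
      split_ifs <;> norm_num
    · simp [hj, Function.update_of_ne (Ne.symm hj)]
  have h1 := h _ _ hs
  have h2 : ∑ x, (ν x - μ x) * s (x i) = ∑ y, |siteMass ν i y - siteMass μ i y| := by
    rw [sum_eq_sum_siteMass i]
    refine Finset.sum_congr rfl fun y _ => ?_
    have h3 : |siteMass ν i y - siteMass μ i y| = (siteMass ν i y - siteMass μ i y) * s y := by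
      simp only [s]
      split_ifs with h4
      · rw [abs_of_nonneg h4, mul_one]
      · rw [abs_of_neg (not_le.1 h4), mul_neg_one]
    rw [h3, siteMass, siteMass, ← Finset.sum_sub_distrib, Finset.sum_mul]
    refine Finset.sum_congr rfl fun x _ => ?_
    split_ifs with hx
    · rw [hx]
    · simp
  rw [h2] at h1
  refine (le_abs_self _).trans (h1.trans ?_)
  simp [hi, mul_comm]

/-- The masses of single spins under all pinned reversible measures are zero or at least `β`. -/
def HasMarginalBound (K : ι → (ι → X) → X → ℝ) (β : ℝ) : Prop :=
  ∀ (S : Finset ι) (μ : (ι → X) → ℝ), IsSpinSystem μ → DetailedBalance K S μ → IsPinnedOff S μ →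
    ∀ i ∈ S, ∀ y, siteMass μ i y = 0 ∨ β ≤ siteMass μ i y

lemma siteMass_nonneg (h0 : ∀ x, 0 ≤ μ x) (i : ι) (y : X) : 0 ≤ siteMass μ i y :=
  Finset.sum_nonneg fun x _ => by split_ifs <;> simp [h0]

lemma eq_zero_of_siteMass_eq_zero (h0 : ∀ x, 0 ≤ μ x) {i : ι} {x : ι → X}
    (h : siteMass μ i (x i) = 0) : μ x = 0 := by
  have := (Finset.sum_eq_zero_iff_of_nonneg (fun x _ => by split_ifs <;> simp [h0])).1 h x
    (Finset.mem_univ _)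
  simpa using this

/-- A spin of mass zero makes both sides vanish, so the disintegration over the spin at `i` needs no
positivity assumption. -/
lemma siteMass_mul_pin (h0 : ∀ x, 0 ≤ μ x) (i : ι) (y : X) (x : ι → X) :
    siteMass μ i y * pin μ i y x = if x i = y then μ x else 0 := by
  rw [pin]
  by_cases h : siteMass μ i y = 0
  · rw [h, zero_mul]
    split_ifs with hx
    · subst hx
      exact (eq_zero_of_siteMass_eq_zero h0 h).symm
    · rfl
  · rw [mul_div_cancel₀ _ h]

lemma isSpinSystem_pin (h0 : ∀ x, 0 ≤ μ x) {i : ι} {y : X} (h : siteMass μ i y ≠ 0) :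
    IsSpinSystem (pin μ i y) := by
  refine ⟨fun x => div_nonneg (by split_ifs <;> simp [h0]) (siteMass_nonneg h0 i y), ?_⟩
  simp only [pin]
  rw [← Finset.sum_div]
  exact div_self h

/-- Resampling a site other than `i` does not touch the spin at `i`, so the same kernels remain
reversible after conditioning. -/
lemma DetailedBalance.pin (hμ : DetailedBalance K S μ) (i : ι) (y : X) :
    DetailedBalance K (S.erase i) (pin μ i y) := by
  intro j hj x c
  have h1 := hμ j (Finset.mem_of_mem_erase hj) x c
  rw [_root_.pin, _root_.pin, Function.update_of_ne (Finset.ne_of_mem_erase hj).symm,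
    div_mul_eq_mul_div, div_mul_eq_mul_div]
  split_ifs
  · rw [h1]
  · simp

lemma IsPinnedOff.pin (hp : IsPinnedOff S μ) (i : ι) (y : X) :
    IsPinnedOff (S.erase i) (pin μ i y) := by
  obtain ⟨z, hz⟩ := hp
  refine ⟨Function.update z i y, fun x hx j hj => ?_⟩
  have h1 : x i = y := by
    by_contra h
    simp [_root_.pin, h] at hx
  have h2 : μ x ≠ 0 := by
    intro h
    simp [_root_.pin, h] at hx
  by_cases hji : j = i
  · subst hji; simpa using h1
  · rw [Function.update_of_ne hji]
    exact hz x h2 j (fun h => hj (Finset.mem_erase.2 ⟨hji, h⟩))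

lemma sum_siteMass_mul_siteForm_pin (h0 : ∀ x, 0 ≤ μ x) (i j : ι) (g : (ι → X) → ℝ) :
    ∑ y, siteMass μ i y * siteForm K (pin μ i y) j g = siteForm K μ j g := by
  rw [siteForm, sum_eq_sum_siteMass i]
  refine Finset.sum_congr rfl fun y _ => ?_
  rw [siteForm, Finset.mul_sum]
  refine Finset.sum_congr rfl fun x _ => ?_
  rw [Finset.mul_sum]
  simp_rw [← mul_assoc, siteMass_mul_pin h0]
  split_ifs <;> simp

/-- The chain rule for the entropy when conditioning on the spin at `i`. -/
lemma entropy_eq_sum_pin (h0 : ∀ x, 0 ≤ μ x) (i : ι) {f : (ι → X) → ℝ} (hf1 : expect μ f = 1) :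
    entropy μ f = ∑ y, siteMass μ i y * entropy (pin μ i y) f
      + ∑ y, siteMass (fun x => f x * μ x) i y
        * Real.log (siteMass (fun x => f x * μ x) i y / siteMass μ i y) := by
  rw [entropy, hf1, Real.log_one, mul_zero, sub_zero, expect, sum_eq_sum_siteMass i,
    ← Finset.sum_add_distrib]
  refine Finset.sum_congr rfl fun y _ => ?_
  have h1 : ∀ u : (ι → X) → ℝ, siteMass μ i y * expect (pin μ i y) u
      = ∑ x, if x i = y then μ x * u x else 0 := by
    intro u
    rw [expect, Finset.mul_sum]
    refine Finset.sum_congr rfl fun x _ => ?_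
    rw [← mul_assoc, siteMass_mul_pin h0]
    split_ifs <;> simp
  have h2 : siteMass μ i y * expect (pin μ i y) f = siteMass (fun x => f x * μ x) i y := by
    rw [h1, siteMass]
    exact Finset.sum_congr rfl fun x _ => by rw [mul_comm]
  rw [entropy, mul_sub, h1, ← mul_assoc, h2]
  by_cases hm : siteMass μ i y = 0
  · rw [← h2, hm]
    simp
  · rw [← h2, mul_div_cancel_left₀ _ hm]
    ring

lemma sum_siteMass (hμ : ∑ x, μ x = 1) (i : ι) : ∑ y, siteMass μ i y = 1 := by
  rw [← hμ, sum_eq_sum_siteMass i]; rfl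

lemma mul_log_div_le {F m β : ℝ} (hF : 0 ≤ F) (hβ : 0 < β) (hm : m = 0 ∨ β ≤ m)
    (h0 : m = 0 → F = 0) : F * Real.log (F / m) ≤ (F - m) ^ 2 / β + (F - m) := by
  rcases hm with hm | hm
  · rw [h0 hm, hm]; simp
  have hm0 : 0 < m := hβ.trans_le hm
  rcases hF.eq_or_lt with h | h
  · rw [← h, zero_mul, zero_sub, neg_sq, ← sub_eq_add_neg, sub_nonneg, le_div_iff₀ hβ]
    nlinarith
  calc F * Real.log (F / m) ≤ F * (F / m - 1) :=
        mul_le_mul_of_nonneg_left (Real.log_le_sub_one_of_pos (div_pos h hm0)) hF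
    _ = (F - m) ^ 2 / m + (F - m) := by field_simp; ring
    _ ≤ _ := by
        gcongr

/-- A reverse Pinsker inequality: relative entropy is at most the χ²-distance, whose denominators
are at least `β`. Then `∑ d² ≤ max |d| ∑ |d|`, and `2 |d y| ≤ ∑ |d|` because the differences sum to
zero. -/
lemma sum_siteMass_mul_log_le {ν : (ι → X) → ℝ} {β : ℝ} (hβ : 0 < β) {i : ι}
    (hν0 : ∀ x, 0 ≤ ν x) (hν1 : ∑ x, ν x = 1) (hμ1 : ∑ x, μ x = 1)
    (hm : ∀ y, siteMass μ i y = 0 ∨ β ≤ siteMass μ i y)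
    (hac : ∀ y, siteMass μ i y = 0 → siteMass ν i y = 0) :
    ∑ y, siteMass ν i y * Real.log (siteMass ν i y / siteMass μ i y)
      ≤ (∑ y, |siteMass ν i y - siteMass μ i y|) ^ 2 / (2 * β) := by
  set d : X → ℝ := fun y => siteMass ν i y - siteMass μ i y with hd
  have hd0 : ∑ y, d y = 0 := by
    rw [hd, Finset.sum_sub_distrib, sum_siteMass hν1, sum_siteMass hμ1, sub_self]
  have h1 : ∀ y, 2 * |d y| ≤ ∑ y, |d y| := by
    intro y
    rw [← Finset.add_sum_erase Finset.univ (fun y => |d y|) (Finset.mem_univ y), two_mul]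
    rw [← Finset.add_sum_erase Finset.univ d (Finset.mem_univ y)] at hd0
    have h2 : |d y| = |∑ y ∈ Finset.univ.erase y, d y| := by
      rw [eq_neg_of_add_eq_zero_left hd0, abs_neg]
    have h3 := Finset.abs_sum_le_sum_abs d (Finset.univ.erase y)
    linarith
  calc ∑ y, siteMass ν i y * Real.log (siteMass ν i y / siteMass μ i y)
      ≤ ∑ y, (d y ^ 2 / β + d y) := Finset.sum_le_sum fun y _ =>
        mul_log_div_le (siteMass_nonneg hν0 i y) hβ (hm y) (hac y)
    _ = (∑ y, d y ^ 2) / β := by rw [Finset.sum_add_distrib, hd0, add_zero, Finset.sum_div]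
    _ ≤ ((∑ y, |d y|) ^ 2 / 2) / β := by
        gcongr
        rw [sq (∑ y, |d y|), Finset.sum_mul, Finset.sum_div]
        refine Finset.sum_le_sum fun y _ => ?_
        have h5 : 2 * (d y ^ 2) ≤ |d y| * ∑ y, |d y| := by
          have := mul_le_mul_of_nonneg_left (h1 y) (abs_nonneg (d y))
          rw [← sq_abs]
          linarith
        linarith
    _ = _ := by rw [div_div]

end DobrushinLSI

/-! ### The logarithmic Sobolev inequality by induction on the free sites -/

section DobrushinLSI

variable {ι X : Type*} [Fintype ι] [DecidableEq ι] [Fintype X] [DecidableEq X]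
variable {K : ι → (ι → X) → X → ℝ} {S : Finset ι} {μ : (ι → X) → ℝ}

/-- Dobrushin's comparison is applied to `h ↦ ν(h) - μ(h)` with ν = g² μ and `b = squareForm`. Its
weight `a i` bounds the total variation distance of the marginals at `i`. -/
lemma sum_marginal_entropy_le [Nonempty X] (hK : IsSiteKernel K) {A : ι → ι → ℝ}
    (hA : HasInfluence K A) {α β : ℝ} (hα : α < 1) (hrow : ∀ i, ∑ j, A i j ≤ α)
    (hcol : ∀ j, ∑ i, A i j ≤ α) (hβ : 0 < β) (hm : HasMarginalBound K β)
    (hμ : IsSpinSystem μ) (hdb : DetailedBalance K S μ) (hp : IsPinnedOff S μ)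
    {g : (ι → X) → ℝ} (hg : expect μ (fun x => g x ^ 2) = 1) :
    ∑ i ∈ S, ∑ y, siteMass (fun x => g x ^ 2 * μ x) i y
        * Real.log (siteMass (fun x => g x ^ 2 * μ x) i y / siteMass μ i y)
      ≤ 2 / (β * (1 - α) ^ 2) * ∑ i ∈ S, siteForm K μ i g := by
  set ν : (ι → X) → ℝ := fun x => g x ^ 2 * μ x with hν
  have hL : ∀ h, ∑ x, (ν x - μ x) * h x
      = expect μ (fun x => g x ^ 2 * h x) - expect μ h := by
    intro h
    rw [expect, expect, ← Finset.sum_sub_distrib]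
    exact Finset.sum_congr rfl fun x _ => by simp only [hν]; ring
  obtain ⟨a, ha0, ha, hmin⟩ := exists_minimal_estimate (S := S) hK hA
    (fun h => expect μ (fun x => g x ^ 2 * h x) - expect μ h) (fun i => squareForm K μ i g)
    (fun i => hK.squareForm_nonneg hμ.1 i g)
    (fun h δ hδ => abs_expect_mul_sub_le hμ hp (fun x => sq_nonneg _) hg hδ)
    (fun i hi h δ hδ => by
      have h1 := hK.abs_expect_sq_mul_sub hdb hμ.1 hi g hδ
      have h2 := abs_add_le
        (expect μ (fun x => g x ^ 2 * h x) - expect μ (fun x => g x ^ 2 * resample K i h x))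
        (expect μ (fun x => g x ^ 2 * resample K i h x) - expect μ (resample K i h))
      rw [sub_add_sub_cancel, hK.expect_resample hdb hi] at h2
      rw [hK.expect_resample hdb hi]
      linarith)
  have hsub : ∀ (f : ι → ℝ), (∀ i, 0 ≤ f i) → ∑ i ∈ S, f i ≤ ∑ i, f i := fun f hf =>
    Finset.sum_le_sum_of_subset_of_nonneg (Finset.subset_univ S) fun i _ _ => hf i
  have hsq := sum_sq_le_of_le_add_sum hα hA.nonneg ha0
    (fun i _ => (hsub _ fun j => hA.nonneg i j).trans (hrow i))
    (fun j _ => (hsub _ fun i => hA.nonneg i j).trans (hcol j)) hmin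
  have hα2 : 0 < (1 - α) ^ 2 := pow_pos (sub_pos.2 hα) 2
  have hV : (1 - α) ^ 2 * ∑ i ∈ S, a i ^ 2 ≤ ∑ i ∈ S, siteForm K μ i g :=
    hsq.trans (Finset.sum_le_sum fun i hi => hK.squareForm_sq_le hdb hμ.1 hi hg)
  have hone : ∀ i ∈ S, ∑ y, siteMass ν i y * Real.log (siteMass ν i y / siteMass μ i y)
      ≤ 2 / β * a i ^ 2 := by
    intro i hi
    have h1 : ∑ y, |siteMass ν i y - siteMass μ i y| ≤ 2 * a i :=
      sum_abs_siteMass_sub_le (fun h δ hδ => by rw [hL]; exact ha h δ hδ) hi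
    have h2 := sum_siteMass_mul_log_le (μ := μ) (ν := ν) hβ (i := i)
      (fun x => mul_nonneg (sq_nonneg _) (hμ.1 x))
      (by rw [← hg]; exact Finset.sum_congr rfl fun x _ => mul_comm _ _) hμ.2
      (hm S μ hμ hdb hp i hi) (by
        intro y hy
        refine Finset.sum_eq_zero fun x _ => ?_
        split_ifs with hx
        · subst hx
          simp [hν, eq_zero_of_siteMass_eq_zero hμ.1 hy]
        · rfl)
    refine h2.trans ?_
    calc _ ≤ (2 * a i) ^ 2 / (2 * β) := by gcongr
      _ = _ := by field_simp
  calc _ ≤ ∑ i ∈ S, 2 / β * a i ^ 2 := Finset.sum_le_sum hone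
    _ = 2 / (β * (1 - α) ^ 2) * ((1 - α) ^ 2 * ∑ i ∈ S, a i ^ 2) := by
        have : (1 - α) ≠ 0 := (sub_pos.2 hα).ne'
        rw [← Finset.mul_sum, ← mul_assoc]
        congr 1
        field_simp
    _ ≤ _ := mul_le_mul_of_nonneg_left hV (by positivity)

omit [DecidableEq X] in
lemma entropy_const_mul {c : ℝ} (hc : 0 < c) {f : (ι → X) → ℝ}
    (hf1 : expect μ f = 1) : entropy μ (fun x => c * f x) = c * entropy μ f := by
  have h1 : ∀ u : (ι → X) → ℝ, expect μ (fun x => c * u x) = c * expect μ u := by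
    intro u
    simp only [expect, Finset.mul_sum]
    exact Finset.sum_congr rfl fun x _ => by ring
  have h2 : expect μ (fun x => c * f x * Real.log (c * f x))
      = c * Real.log c + c * expect μ (fun x => f x * Real.log (f x)) := by
    rw [← h1]
    nth_rw 1 [← mul_one (c * Real.log c)]
    rw [← hf1]
    simp only [expect]
    rw [Finset.mul_sum, ← Finset.sum_add_distrib]
    refine Finset.sum_congr rfl fun x _ => ?_
    by_cases hx : f x = 0
    · simp [hx]
    · rw [Real.log_mul hc.ne' hx]
      ring
  rw [entropy, entropy, h1, hf1, h2, mul_one, Real.log_one]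
  ring

omit [DecidableEq X] in
lemma entropy_sq_eq_zero (h0 : ∀ x, 0 ≤ μ x) {g : (ι → X) → ℝ}
    (hg : expect μ (fun x => g x ^ 2) = 0) : entropy μ (fun x => g x ^ 2) = 0 := by
  have h1 : ∀ x, μ x * g x ^ 2 = 0 := fun x =>
    (Finset.sum_eq_zero_iff_of_nonneg (fun x _ => mul_nonneg (h0 x) (sq_nonneg _))).1 hg x
      (Finset.mem_univ x)
  rw [entropy, hg, zero_mul, sub_zero, expect]
  refine Finset.sum_eq_zero fun x _ => ?_
  rw [← mul_assoc, h1, zero_mul]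

omit [DecidableEq X] in
/-- To bound the entropy of squares it suffices to consider normalized functions. -/
lemma entropy_sq_le_of_normalized (hμ : IsSpinSystem μ) (hK : IsSiteKernel K) {C : ℝ}
    (hC : 0 ≤ C)
    (h : ∀ g : (ι → X) → ℝ, expect μ (fun x => g x ^ 2) = 1 →
      entropy μ (fun x => g x ^ 2) ≤ C * ∑ i ∈ S, siteForm K μ i g) (g : (ι → X) → ℝ) :
    entropy μ (fun x => g x ^ 2) ≤ C * ∑ i ∈ S, siteForm K μ i g := by
  have hm0 : 0 ≤ expect μ (fun x => g x ^ 2) :=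
    Finset.sum_nonneg fun x _ => mul_nonneg (hμ.1 x) (sq_nonneg _)
  rcases hm0.eq_or_lt with hm | hm
  · rw [entropy_sq_eq_zero hμ.1 hm.symm]
    exact mul_nonneg hC (Finset.sum_nonneg fun i _ => siteForm_nonneg hK hμ.1 i g)
  set m := expect μ (fun x => g x ^ 2) with hmdef
  set u : (ι → X) → ℝ := fun x => g x / √m with hu
  have hgu : ∀ x, g x = √m * u x := fun x => by
    rw [hu, mul_div_cancel₀ _ (Real.sqrt_pos.2 hm).ne']
  have hsq : ∀ x, g x ^ 2 = m * u x ^ 2 := fun x => by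
    rw [hgu, mul_pow, Real.sq_sqrt hm.le]
  have hu1 : expect μ (fun x => u x ^ 2) = 1 := by
    have : m = m * expect μ (fun x => u x ^ 2) := by
      conv_lhs => rw [hmdef]
      simp only [expect, Finset.mul_sum]
      exact Finset.sum_congr rfl fun x _ => by rw [hsq]; ring
    exact (mul_right_eq_self₀.1 this.symm).resolve_right hm.ne'
  have h1 := h u hu1
  simp_rw [hsq]
  rw [entropy_const_mul hm hu1]
  have h2 : ∑ i ∈ S, siteForm K μ i g = m * ∑ i ∈ S, siteForm K μ i u := by
    rw [Finset.mul_sum]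
    refine Finset.sum_congr rfl fun i _ => ?_
    simp only [siteForm, Finset.mul_sum]
    refine Finset.sum_congr rfl fun x _ => Finset.sum_congr rfl fun y _ => ?_
    rw [hgu, hgu (Function.update x i y), ← mul_sub, mul_pow, Real.sq_sqrt hm.le]
    ring
  rw [h2, mul_left_comm]
  exact mul_le_mul_of_nonneg_left h1 hm.le

omit [DecidableEq X] in
lemma entropy_eq_zero_of_isPinnedOff_empty (hμ : IsSpinSystem μ) (hp : IsPinnedOff ∅ μ)
    (f : (ι → X) → ℝ) : entropy μ f = 0 := by
  obtain ⟨z, hz⟩ := hp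
  have h0 : ∀ x, x ≠ z → μ x = 0 := fun x hx => by
    by_contra h
    exact hx (funext fun i => hz x h i (Finset.notMem_empty i))
  have h1 : ∀ u : (ι → X) → ℝ, expect μ u = μ z * u z := fun u =>
    Finset.sum_eq_single z (fun x _ hx => by rw [h0 x hx, zero_mul]) (by simp)
  have h2 : μ z = 1 := by
    rw [← hμ.2]
    exact (Finset.sum_eq_single z (fun x _ hx => h0 x hx) (by simp)).symm
  rw [entropy, h1, h1, h2]
  simp only [one_mul, sub_self]

/-- The logarithmic Sobolev inequality under Dobrushin's condition, for pinned measures. -/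
theorem entropy_sq_le_of_influence [Nonempty X] (hK : IsSiteKernel K) {A : ι → ι → ℝ}
    (hA : HasInfluence K A) {α β : ℝ} (hα : α < 1) (hrow : ∀ i, ∑ j, A i j ≤ α)
    (hcol : ∀ j, ∑ i, A i j ≤ α) (hβ : 0 < β) (hm : HasMarginalBound K β)
    (hμ : IsSpinSystem μ) (hdb : DetailedBalance K S μ) (hp : IsPinnedOff S μ)
    (g : (ι → X) → ℝ) :
    entropy μ (fun x => g x ^ 2) ≤ 2 / (β * (1 - α) ^ 2) * ∑ i ∈ S, siteForm K μ i g := by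
  have hC : 0 ≤ 2 / (β * (1 - α) ^ 2) := by positivity
  -- The kernels, the influence matrix and `β` are the same for all pinned measures, so the constant
  -- does not deteriorate along the induction.
  induction hn : S.card generalizing S μ g with
  | zero =>
    rw [Finset.card_eq_zero] at hn
    subst hn
    rw [entropy_eq_zero_of_isPinnedOff_empty hμ hp]
    simp
  | succ n ih =>
    revert g
    refine fun g => entropy_sq_le_of_normalized hμ hK hC (fun g hg => ?_) g
    set C := 2 / (β * (1 - α) ^ 2)
    set V := ∑ i ∈ S, siteForm K μ i g with hV
    have h1 : ∀ i ∈ S, ∑ y, siteMass μ i y * entropy (pin μ i y) (fun x => g x ^ 2)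
        ≤ C * (V - siteForm K μ i g) := by
      intro i hi
      calc _ ≤ ∑ y, C * ∑ j ∈ S.erase i, siteMass μ i y * siteForm K (pin μ i y) j g := by
            refine Finset.sum_le_sum fun y _ => ?_
            rw [← Finset.mul_sum, mul_left_comm]
            rcases (siteMass_nonneg hμ.1 i y).eq_or_lt with h | h
            · simp [← h]
            refine mul_le_mul_of_nonneg_left ?_ h.le
            exact ih (isSpinSystem_pin hμ.1 h.ne') (hdb.pin i y) (hp.pin i y) g
              (by rw [Finset.card_erase_of_mem hi, hn]; rfl)
        _ = C * ∑ j ∈ S.erase i, siteForm K μ j g := by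
            rw [← Finset.mul_sum, Finset.sum_comm]
            congr 1
            exact Finset.sum_congr rfl fun j _ => sum_siteMass_mul_siteForm_pin hμ.1 i j g
        _ = _ := by rw [hV, ← Finset.sum_erase_add S _ hi, add_sub_cancel_right]
    -- The chain rule is summed over all `i ∈ S`. The forms lost by pinning add up to exactly one `C
    -- * V`, which is what the marginal entropies cost.
    have h2 : (S.card : ℝ) * entropy μ (fun x => g x ^ 2)
        ≤ ∑ i ∈ S, C * (V - siteForm K μ i g) + C * V := by
      calc (S.card : ℝ) * entropy μ (fun x => g x ^ 2)
          = ∑ i ∈ S, ∑ y, siteMass μ i y * entropy (pin μ i y) (fun x => g x ^ 2)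
            + ∑ i ∈ S, ∑ y, siteMass (fun x => g x ^ 2 * μ x) i y
              * Real.log (siteMass (fun x => g x ^ 2 * μ x) i y / siteMass μ i y) := by
            rw [← Finset.sum_add_distrib, ← nsmul_eq_mul, ← Finset.sum_const]
            exact Finset.sum_congr rfl fun i _ => entropy_eq_sum_pin hμ.1 i hg
        _ ≤ _ := add_le_add (Finset.sum_le_sum h1)
            (sum_marginal_entropy_le hK hA hα hrow hcol hβ hm hμ hdb hp hg)
    have h3 : ∑ i ∈ S, C * (V - siteForm K μ i g) + C * V = S.card * (C * V) := by
      rw [← Finset.mul_sum, Finset.sum_sub_distrib, Finset.sum_const, ← hV, nsmul_eq_mul]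
      ring
    rw [h3] at h2
    exact le_of_mul_le_mul_left h2 (by rw [hn]; positivity)

omit [DecidableEq X] in
lemma sum_siteForm_eq (hK : IsSiteKernel K) (hμ : IsSpinSystem μ)
    (hdb : DetailedBalance K Finset.univ μ) (g : (ι → X) → ℝ) :
    ∑ i, siteForm K μ i g = 2 * expect μ (fun x => ∑ i, localVariance μ g i x) := by
  have : expect μ (fun x => ∑ i, localVariance μ g i x)
      = ∑ i, expect μ (localVariance μ g i) := by
    simp only [expect, Finset.mul_sum]
    exact Finset.sum_comm
  rw [this, Finset.mul_sum]
  exact Finset.sum_congr rfl fun i _ => hK.siteForm_eq hdb hμ.1 (Finset.mem_univ i) g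

omit [DecidableEq ι] [Fintype X] [DecidableEq X] in
lemma isPinnedOff_univ [Nonempty X] : IsPinnedOff Finset.univ μ :=
  ⟨fun _ => Classical.arbitrary X, fun _ _ i hi => absurd (Finset.mem_univ i) hi⟩

theorem satisfiesLSI_of_influence [Nonempty X] (hK : IsSiteKernel K) {A : ι → ι → ℝ}
    (hA : HasInfluence K A) {α β : ℝ} (hα : α < 1) (hrow : ∀ i, ∑ j, A i j ≤ α)
    (hcol : ∀ j, ∑ i, A i j ≤ α) (hβ : 0 < β) (hm : HasMarginalBound K β)
    (hμ : IsSpinSystem μ) (hdb : DetailedBalance K Finset.univ μ) :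
    SatisfiesLSI μ (2 / (β * (1 - α) ^ 2)) := by
  refine ⟨hμ, fun g => ?_⟩
  refine (entropy_sq_le_of_influence hK hA hα hrow hcol hβ hm hμ hdb isPinnedOff_univ g).trans (le_of_eq ?_)
  rw [sum_siteForm_eq hK hμ hdb]
  ring

omit [DecidableEq X] in
lemma SatisfiesLSI.mono {σ τ : ℝ} (h : SatisfiesLSI μ σ) (hστ : σ ≤ τ) : SatisfiesLSI μ τ := by
  refine ⟨h.1, fun f => (h.2 f).trans ?_⟩
  have h0 : 0 ≤ expect μ (fun x => ∑ i, localVariance μ f i x) := by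
    refine Finset.sum_nonneg fun x _ => mul_nonneg (h.1.1 x) (Finset.sum_nonneg fun i _ => ?_)
    rw [localVariance]
    have hc : ∀ y, 0 ≤ condProb μ i x y := fun y =>
      div_nonneg (h.1.1 _) (Finset.sum_nonneg fun _ _ => h.1.1 _)
    split_ifs
    · refine mul_nonneg (by norm_num) (Finset.sum_nonneg fun y _ => Finset.sum_nonneg fun y' _ => ?_)
      exact mul_nonneg (mul_nonneg (sq_nonneg _) (hc y)) (hc y')
    · rfl
  gcongr

/-- A uniform lower bound for the resampling probabilities bounds the marginals from below. -/
lemma hasMarginalBound_of_le (hK : IsSiteKernel K) {β : ℝ} (h : ∀ i x y, β ≤ K i x y) :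
    HasMarginalBound K β := by
  intro S μ hμ hdb _ i hi y
  right
  have h1 : siteMass μ i y = expect μ (resample K i fun x => if x i = y then 1 else 0) := by
    rw [hK.expect_resample hdb hi]
    exact Finset.sum_congr rfl fun x _ => by simp
  rw [h1]
  calc β = ∑ x, μ x * β := by rw [← Finset.sum_mul, hμ.2, one_mul]
    _ ≤ _ := Finset.sum_le_sum fun x _ => mul_le_mul_of_nonneg_left
        (by simpa [resample] using h i x y) (hμ.1 x)

end DobrushinLSI

/-! ### Kernels from weights, and repeated resampling -/

section NormalizedKernel

variable {ι X : Type*} [Fintype ι] [DecidableEq ι] [Fintype X]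

/-- The site kernels proportional to the weights `k`. -/
noncomputable def normalizedKernel (k : ι → (ι → X) → X → ℝ) (i : ι) (x : ι → X) (y : X) : ℝ :=
  k i x y / ∑ c, k i x c

variable {k : ι → (ι → X) → X → ℝ}

omit [Fintype ι] in
lemma isSiteKernel_normalizedKernel (h0 : ∀ i x y, 0 ≤ k i x y) (hpos : ∀ i x, 0 < ∑ y, k i x y)
    (hu : ∀ i x y, k i (Function.update x i y) = k i x) : IsSiteKernel (normalizedKernel k) where
  nonneg i x y := div_nonneg (h0 i x y) (hpos i x).le
  sum_eq_one i x := by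
    simp only [normalizedKernel]
    rw [← Finset.sum_div, div_self (hpos i x).ne']
  update_eq i x y := by
    ext c
    simp only [normalizedKernel, hu]

lemma isSpinSystem_normalized {w : (ι → X) → ℝ} (h0 : ∀ x, 0 ≤ w x) (hpos : 0 < ∑ x, w x) :
    IsSpinSystem (normalized w) := by
  refine ⟨fun x => div_nonneg (h0 x) hpos.le, ?_⟩
  simp only [normalized]
  rw [← Finset.sum_div, div_self hpos.ne']

/-- Both sides equal `g i x * k i x (x i) * k i x y` divided by the same two normalizations. -/
lemma detailedBalance_normalized {w : (ι → X) → ℝ} (g : ι → (ι → X) → ℝ)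
    (hw : ∀ i x y, w (Function.update x i y) = g i x * k i x y) (S : Finset ι) :
    DetailedBalance (normalizedKernel k) S (normalized w) := by
  intro i _ x y
  have h1 := hw i x (x i)
  rw [Function.update_eq_self] at h1
  rw [normalized, normalized, normalizedKernel, normalizedKernel, hw, h1]
  ring

lemma sum_max_sub_comm {u v : X → ℝ} (h : ∑ y, u y = ∑ y, v y) :
    ∑ y, max (u y - v y) 0 = ∑ y, max (v y - u y) 0 := by
  rw [← sub_eq_zero, ← Finset.sum_sub_distrib]
  have : ∀ y, max (u y - v y) 0 - max (v y - u y) 0 = u y - v y := by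
    intro y
    rcases le_total (u y) (v y) with hy | hy
    · rw [max_eq_right (by linarith), max_eq_left (by linarith)]; ring
    · rw [max_eq_left (by linarith), max_eq_right (by linarith)]; ring
  simp_rw [this]
  rw [Finset.sum_sub_distrib, h, sub_self]

lemma sum_max_sub_fin_two {u v : Fin 2 → ℝ} (h : ∑ y, u y = ∑ y, v y) :
    ∑ y, max (u y - v y) 0 = |u 1 - v 1| := by
  rw [Fin.sum_univ_two, Fin.sum_univ_two] at h
  rw [Fin.sum_univ_two, show u 0 - v 0 = -(u 1 - v 1) by linarith]
  rcases le_total 0 (u 1 - v 1) with hy | hy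
  · rw [max_eq_right (by linarith), max_eq_left hy, abs_of_nonneg hy, zero_add]
  · rw [max_eq_left (by linarith), max_eq_right hy, abs_of_nonpos hy, add_zero]

/-- Repeated resampling shows that the sites in `T` are simultaneously good with a probability
bounded from below. -/
lemma pow_le_expect_forall {K : ι → (ι → X) → X → ℝ} {S : Finset ι} {μ : (ι → X) → ℝ}
    (hK : IsSiteKernel K) (hμ : IsSpinSystem μ) (hdb : DetailedBalance K S μ) (good : X → Prop)
    [DecidablePred good] {r : ℝ} (hr0 : 0 ≤ r) {T : Finset ι} (hTS : T ⊆ S)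
    (hr : ∀ j ∈ T, ∀ x, r ≤ ∑ y, if good y then K j x y else 0) :
    r ^ T.card ≤ expect μ (fun x => if ∀ j ∈ T, good (x j) then 1 else 0) := by
  induction T using Finset.induction_on with
  | empty => simp [expect, hμ.2]
  | insert j T hj ih =>
    have h1 := ih ((Finset.subset_insert j T).trans hTS)
      (fun l hl => hr l (Finset.mem_insert_of_mem hl))
    -- Resampling `j` leaves the spins in `T` unchanged, so each new site contributes a conditional
    -- factor of at least `r`.
    rw [Finset.card_insert_of_notMem hj, pow_succ,
      ← hK.expect_resample hdb (hTS (Finset.mem_insert_self j T))]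
    refine (mul_le_mul_of_nonneg_right h1 hr0).trans ?_
    rw [expect, Finset.sum_mul]
    refine Finset.sum_le_sum fun x _ => ?_
    rw [mul_assoc]
    refine mul_le_mul_of_nonneg_left ?_ (hμ.1 x)
    have h2 : ∀ y, (∀ l ∈ insert j T, good (Function.update x j y l))
        ↔ (good y ∧ ∀ l ∈ T, good (x l)) := by
      intro y
      rw [Finset.forall_mem_insert, Function.update_self]
      refine and_congr_right fun _ => forall₂_congr fun l hl => ?_
      rw [Function.update_of_ne (by rintro rfl; exact hj hl)]
    simp only [resample, h2]
    by_cases hT : ∀ l ∈ T, good (x l)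
    · simp only [if_pos hT, and_iff_left hT, one_mul, mul_ite, mul_one, mul_zero]
      exact hr j (Finset.mem_insert_self j T) x
    · simp [hT]

end NormalizedKernel

/-! ### Models with hard constraints on adjacent spins -/

section HardConstraint

variable {V X : Type*}

open scoped Classical in
/-- The weight of a configuration with single-spin weights `q` in which the spins of adjacent
vertices have to satisfy the relation `R`. -/
noncomputable def constraintWeight [Fintype V] (G : SimpleGraph V) (R : X → X → Prop) (q : X → ℝ)
    (x : V → X) : ℝ :=
  if ∀ a b, G.Adj a b → R (x a) (x b) then ∏ a, q (x a) else 0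

open scoped Classical in
/-- The conditional weight of the spin `y` at `i`. -/
noncomputable def constraintSiteWeight (G : SimpleGraph V) (R : X → X → Prop) (q : X → ℝ)
    (i : V) (x : V → X) (y : X) : ℝ :=
  if ∀ j, G.Adj i j → R y (x j) then q y else 0

variable [Fintype V] [DecidableEq V] [Fintype X]
variable {G : SimpleGraph V} {R : X → X → Prop} {q : X → ℝ}

omit [Fintype V] [Fintype X] in
lemma constraintSiteWeight_update (i : V) (x : V → X) (y : X) :
    constraintSiteWeight G R q i (Function.update x i y) = constraintSiteWeight G R q i x := by
  classical
  ext c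
  unfold constraintSiteWeight
  refine if_congr (forall₂_congr fun j hj => ?_) rfl rfl
  rw [Function.update_of_ne hj.ne']

omit [Fintype V] [Fintype X] in
lemma constraintSiteWeight_update_of_not_adj {i j : V} (h : ¬ G.Adj i j) (x : V → X) (c : X) :
    constraintSiteWeight G R q i (Function.update x j c) = constraintSiteWeight G R q i x := by
  classical
  ext y
  unfold constraintSiteWeight
  refine if_congr (forall₂_congr fun l hl => ?_) rfl rfl
  rw [Function.update_of_ne (by rintro rfl; exact h hl)]

-- The constraints at `i` separate from those among the other vertices. Symmetry of `R` lets an edge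
-- at `i` be read in either direction.
open scoped Classical in
omit [Fintype X] in
lemma constraintWeight_update (hR : ∀ a b, R a b → R b a) (i : V) (x : V → X) (y : X) :
    constraintWeight G R q (Function.update x i y)
      = (if ∀ a b, a ≠ i → b ≠ i → G.Adj a b → R (x a) (x b) then
          ∏ a ∈ Finset.univ.erase i, q (x a) else 0) * constraintSiteWeight G R q i x y := by
  have h1 : (∀ a b, G.Adj a b → R (Function.update x i y a) (Function.update x i y b)) ↔
      (∀ a b, a ≠ i → b ≠ i → G.Adj a b → R (x a) (x b)) ∧ ∀ j, G.Adj i j → R y (x j) := by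
    constructor
    · refine fun h => ⟨fun a b ha hb hab => ?_, fun j hj => ?_⟩
      · simpa [ha, hb] using h a b hab
      · simpa [hj.ne'] using h i j hj
    · rintro ⟨h, h'⟩ a b hab
      by_cases ha : a = i
      · subst ha
        simpa [hab.ne'] using h' b hab
      · by_cases hb : b = i
        · subst hb
          simpa [ha] using hR _ _ (h' a hab.symm)
        · simpa [ha, hb] using h a b ha hb hab
  have h2 : ∏ a, q (Function.update x i y a)
      = (∏ a ∈ Finset.univ.erase i, q (x a)) * q y := by
    rw [← Finset.prod_erase_mul _ _ (Finset.mem_univ i), Function.update_self]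
    congr 1
    exact Finset.prod_congr rfl fun a ha => by rw [Function.update_of_ne (Finset.ne_of_mem_erase ha)]
  rw [constraintWeight, constraintSiteWeight, h2, ite_zero_mul_ite_zero]
  by_cases h3 : ∀ a b, G.Adj a b → R (Function.update x i y a) (Function.update x i y b)
  · rw [if_pos h3, if_pos (h1.1 h3)]
  · rw [if_neg h3, if_neg (mt h1.2 h3)]

/-- The heat-bath kernels of the model with hard constraints. -/
noncomputable abbrev constraintKernel {V X : Type*} [Fintype X] (G : SimpleGraph V) (R : X → X → Prop) (q : X → ℝ) :
    V → (V → X) → X → ℝ :=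
  normalizedKernel (constraintSiteWeight G R q)

open scoped Classical in
lemma hasMarginalBound_constraintKernel [DecidableEq X] [DecidableRel G.Adj] {Δ : ℕ}
    (hΔ : G.maxDegree ≤ Δ)
    (hK : IsSiteKernel (constraintKernel G R q)) {r r' : ℝ} (hr0 : 0 ≤ r) (hr1 : r ≤ 1)
    (hr0' : 0 ≤ r')
    (hr : ∀ y i j x, G.Adj i j → r ≤ ∑ c, if R y c then constraintKernel G R q j x c else 0)
    (hr' : ∀ y, (∀ i x, constraintKernel G R q i x y = 0) ∨
      ∀ i x, (∀ j, G.Adj i j → R y (x j)) → r' ≤ constraintKernel G R q i x y) :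
    HasMarginalBound (constraintKernel G R q) (r ^ Δ * r') := by
  intro S μ hμ hdb hp i hi y
  obtain ⟨z, hz⟩ := hp
  have hmass : siteMass μ i y = ∑ x, μ x * constraintKernel G R q i x y := by
    have h1 : siteMass μ i y
        = expect μ (resample (constraintKernel G R q) i fun x => if x i = y then 1 else 0) := by
      rw [hK.expect_resample hdb hi]
      exact Finset.sum_congr rfl fun x _ => by simp
    rw [h1]
    exact Finset.sum_congr rfl fun x _ => by simp [resample]
  rcases hr' y with h0 | h0
  · left
    rw [hmass]
    simp [h0]
  -- An incompatible pinned neighbor forces mass zero. Otherwise only the free neighbors, at most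
  -- `Δ` of them, must become compatible with `y`: this has probability at least `r ^ Δ`, and then
  -- `y` is chosen with probability at least `r'`.
  by_cases hpin : ∃ j, j ∉ S ∧ G.Adj i j ∧ ¬ R y (z j)
  · left
    obtain ⟨j, hjS, hij, hj⟩ := hpin
    rw [hmass]
    refine Finset.sum_eq_zero fun x _ => ?_
    by_cases hx : μ x = 0
    · rw [hx, zero_mul]
    have h2 : constraintSiteWeight G R q i x y = 0 :=
      if_neg fun h => hj (by rw [← hz x hx j hjS]; exact h j hij)
    rw [constraintKernel, normalizedKernel, h2, zero_div, mul_zero]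
  · right
    push Not at hpin
    have h3 := pow_le_expect_forall hK hμ hdb (fun c => R y c) hr0 (T := S.filter (G.Adj i))
      (Finset.filter_subset _ _) (fun j hj x => hr y i j x (Finset.mem_filter.1 hj).2)
    have h4 : (S.filter (G.Adj i)).card ≤ Δ := by
      refine le_trans ?_ ((G.degree_le_maxDegree i).trans hΔ)
      rw [← G.card_neighborFinset_eq_degree]
      refine Finset.card_le_card fun j hj => ?_
      simpa using (Finset.mem_filter.1 hj).2
    calc r ^ Δ * r' ≤ r ^ (S.filter (G.Adj i)).card * r' :=
          mul_le_mul_of_nonneg_right (pow_le_pow_of_le_one hr0 hr1 h4) hr0'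
      _ ≤ _ := mul_le_mul_of_nonneg_right h3 hr0'
      _ ≤ _ := by
          rw [hmass, expect, Finset.sum_mul]
          refine Finset.sum_le_sum fun x _ => ?_
          rw [mul_assoc]
          by_cases hx : μ x = 0
          · simp [hx]
          refine mul_le_mul_of_nonneg_left ?_ (hμ.1 x)
          split_ifs with h5
          · rw [one_mul]
            refine h0 i x fun j hij => ?_
            by_cases hjS : j ∈ S
            · exact h5 j (Finset.mem_filter.2 ⟨hjS, hij⟩)
            · rw [hz x hx j hjS]
              exact hpin j hjS hij
          · rw [zero_mul]
            exact hK.nonneg i x y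

open scoped Classical in
/-- The logarithmic Sobolev inequality for models with hard constraints. -/
lemma satisfiesLSI_constraint [DecidableEq X] [Nonempty X] [DecidableRel G.Adj] {Δ : ℕ}
    (hΔ : G.maxDegree ≤ Δ) (hR : ∀ a b, R a b → R b a) (hq : ∀ y, 0 ≤ q y)
    (hw : 0 < ∑ x, constraintWeight G R q x)
    (hpos : ∀ i x, 0 < ∑ y, constraintSiteWeight G R q i x y) {t r r' : ℝ}
    (ht : ∀ i j x c, G.Adj i j → ∑ y, max (constraintKernel G R q i (Function.update x j c) y
      - constraintKernel G R q i x y) 0 ≤ t)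
    (ht0 : 0 ≤ t) (ht1 : Δ * t < 1) (hr0 : 0 < r) (hr1 : r ≤ 1) (hr0' : 0 < r')
    (hr : ∀ y i j x, G.Adj i j → r ≤ ∑ c, if R y c then constraintKernel G R q j x c else 0)
    (hr' : ∀ y, (∀ i x, constraintKernel G R q i x y = 0) ∨
      ∀ i x, (∀ j, G.Adj i j → R y (x j)) → r' ≤ constraintKernel G R q i x y) :
    SatisfiesLSI (normalized (constraintWeight G R q)) (2 / (r ^ Δ * r' * (1 - Δ * t) ^ 2)) := by
  have hK : IsSiteKernel (constraintKernel G R q) := isSiteKernel_normalizedKernel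
    (fun i x y => by rw [constraintSiteWeight]; split_ifs <;> simp [hq]) hpos
    constraintSiteWeight_update
  have hrow : ∀ i, ∑ j, (if G.Adj i j then t else 0) ≤ Δ * t := by
    intro i
    rw [← Finset.sum_filter, Finset.sum_const, nsmul_eq_mul, ← G.neighborFinset_eq_filter,
      G.card_neighborFinset_eq_degree]
    refine mul_le_mul_of_nonneg_right ?_ ht0
    exact_mod_cast (G.degree_le_maxDegree i).trans hΔ
  refine satisfiesLSI_of_influence hK (A := fun i j => if G.Adj i j then t else 0) ?_ ht1 hrow
    (fun j => ?_) (by positivity)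
    (hasMarginalBound_constraintKernel hΔ hK hr0.le hr1 hr0'.le hr hr')
    (isSpinSystem_normalized (fun x => ?_) hw)
    (detailedBalance_normalized _ (constraintWeight_update hR) _)
  · intro i j x c
    dsimp only
    split_ifs with hij
    · exact ht i j x c hij
    · simp [constraintKernel, normalizedKernel, constraintSiteWeight_update_of_not_adj hij]
  · simp_rw [G.adj_comm]
    exact hrow j
  · rw [constraintWeight]
    split_ifs
    · exact Finset.prod_nonneg fun a _ => hq _
    · rfl

end HardConstraint

/-! ### The hard-core model -/

section HardCore

lemma div_one_add_le {w lam : ℝ} (hw : 0 ≤ w) (h : w ≤ lam) : w / (1 + w) ≤ lam / (1 + lam) := by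
  rw [div_le_div_iff₀ (by linarith) (by linarith)]
  nlinarith

-- The occupation probability always lies between 0 and `lam / (1 + lam)`, which therefore bounds
-- the influence of a neighbor; `Δ` times this is below 1 exactly when `lam * (Δ - 1) < 1`. A vacant
-- neighbor is compatible with every spin, so `r = 1 / (1 + lam)`.
open scoped Classical in
theorem exists_satisfiesLSI_hardCore (Δ : ℕ) (lam : ℝ) (h0 : 0 ≤ lam)
    (h1 : lam * ((Δ : ℝ) - 1) < 1) :
    ∃ σ2 : ℝ, 0 < σ2 ∧
      ∀ (V : Type*) [Fintype V] [DecidableEq V] (G : SimpleGraph V) [DecidableRel G.Adj],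
        G.maxDegree ≤ Δ → SatisfiesLSI (hardCore G lam) σ2 := by
  have hl : 0 < 1 + lam := by linarith
  -- At `lam = 0` the occupied spin never occurs, so a positive `r'` only has to bound the vacancy
  -- probability.
  obtain ⟨r', hr0', hr1', hr2'⟩ : ∃ r' : ℝ, 0 < r' ∧ r' ≤ 1 / (1 + lam) ∧
      (0 < lam → r' ≤ lam / (1 + lam)) := by
    rcases h0.eq_or_lt with h | h
    · exact ⟨1 / (1 + lam), by positivity, le_rfl, fun h' => absurd h h'.ne⟩
    · exact ⟨min (1 / (1 + lam)) (lam / (1 + lam)), lt_min (by positivity) (by positivity),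
        min_le_left _ _, fun _ => min_le_right _ _⟩
  have ht1 : Δ * (lam / (1 + lam)) < 1 := by
    rw [← mul_div_assoc, div_lt_one hl]
    linarith
  have hα : 0 < 1 - Δ * (lam / (1 + lam)) := by linarith
  refine ⟨2 / ((1 / (1 + lam)) ^ Δ * r' * (1 - Δ * (lam / (1 + lam))) ^ 2), by positivity, ?_⟩
  intro V _ _ G _ hΔ
  let R : Fin 2 → Fin 2 → Prop := fun a b => a.val * b.val = 0
  let q : Fin 2 → ℝ := fun y => lam ^ y.val
  have hmodel : hardCore G lam = normalized (constraintWeight G R q) := by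
    rw [hardCore]
    congr 1
    ext x
    rw [Set.indicator_apply, constraintWeight]
    congr
  have hq : ∀ y, 0 ≤ q y := fun y => pow_nonneg h0 _
  have hw0 : ∀ i (x : V → Fin 2), constraintSiteWeight G R q i x 0 = 1 := by
    intro i x
    simp [constraintSiteWeight, R, q]
  have hw1 : ∀ i (x : V → Fin 2), 0 ≤ constraintSiteWeight G R q i x 1 ∧
      constraintSiteWeight G R q i x 1 ≤ lam := by
    intro i x
    rw [constraintSiteWeight]
    split_ifs <;> simp [q, h0]
  have hsum : ∀ i (x : V → Fin 2), ∑ y, constraintSiteWeight G R q i x y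
      = 1 + constraintSiteWeight G R q i x 1 := by
    intro i x
    rw [Fin.sum_univ_two, hw0]
  have hpos : ∀ i (x : V → Fin 2), 0 < ∑ y, constraintSiteWeight G R q i x y := by
    intro i x
    rw [hsum]
    linarith [(hw1 i x).1]
  have hK0 : ∀ i (x : V → Fin 2), 1 / (1 + lam) ≤ constraintKernel G R q i x 0 := by
    intro i x
    rw [constraintKernel, normalizedKernel, hw0, hsum]
    exact one_div_le_one_div_of_le (by linarith [(hw1 i x).1]) (by linarith [(hw1 i x).2])
  have hK1 : ∀ i (x : V → Fin 2), constraintKernel G R q i x 1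
      = constraintSiteWeight G R q i x 1 / (1 + constraintSiteWeight G R q i x 1) := by
    intro i x
    rw [constraintKernel, normalizedKernel, hsum]
  have hK1' : ∀ i (x : V → Fin 2), 0 ≤ constraintKernel G R q i x 1 ∧
      constraintKernel G R q i x 1 ≤ lam / (1 + lam) := by
    intro i x
    rw [hK1]
    exact ⟨div_nonneg (hw1 i x).1 (by linarith [(hw1 i x).1]),
      div_one_add_le (hw1 i x).1 (hw1 i x).2⟩
  have hKs : ∀ i (x : V → Fin 2), ∑ y, constraintKernel G R q i x y = 1 := by
    intro i x
    simp only [constraintKernel, normalizedKernel]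
    rw [← Finset.sum_div, div_self (hpos i x).ne']
  have hcw : ∀ x : V → Fin 2, 0 ≤ constraintWeight G R q x := by
    intro x
    rw [constraintWeight]
    split_ifs
    · exact Finset.prod_nonneg fun a _ => hq _
    · rfl
  rw [hmodel]
  refine satisfiesLSI_constraint hΔ (fun a b h => (mul_comm _ _).trans h) hq ?_ hpos
    (t := lam / (1 + lam)) ?_ (by positivity) ht1 (by positivity) ?_ hr0' ?_ ?_
  · refine Finset.sum_pos' (fun x _ => hcw x) ⟨0, Finset.mem_univ _, ?_⟩
    simp [constraintWeight, q]
  · intro i j x c _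
    rw [sum_max_sub_fin_two ((hKs _ _).trans (hKs _ _).symm)]
    have h2 := hK1' i x
    have h3 := hK1' i (Function.update x j c)
    rw [abs_le]
    constructor <;> linarith
  · rw [div_le_one hl]
    linarith
  · intro y i j x _
    refine (hK0 j x).trans ?_
    rw [Fin.sum_univ_two, if_pos (show R y 0 by simp [R])]
    have := (hK1' j x).1
    split_ifs <;> linarith
  · intro y
    fin_cases y
    · exact Or.inr fun i x _ => hr1'.trans (hK0 i x)
    · rcases h0.eq_or_lt with h | h
      · left
        intro i x
        have := hK1' i x
        rw [← h, zero_div] at this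
        exact le_antisymm this.2 this.1
      · right
        intro i x hx
        have h2 : constraintSiteWeight G R q i x 1 = lam := by
          unfold constraintSiteWeight
          refine (if_pos hx).trans ?_
          simp [q]
        change r' ≤ constraintKernel G R q i x 1
        rw [hK1, h2]
        exact hr2' h

end HardCore

/-! ### Random colorings -/

section Coloring

/-- By symmetry `B` may be taken to be the larger set. Common elements then contribute nothing, and
the at most one element of `B \ B'` contributes at most `1 / m`. -/
lemma sum_max_uniform_sub_le {X : Type*} [Fintype X] [DecidableEq X] {B B' : Finset X} {m : ℕ}
    (hm : 0 < m) (hB : m ≤ B.card) (hB' : m ≤ B'.card) (h : (B \ B').card ≤ 1)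
    (h' : (B' \ B).card ≤ 1) :
    ∑ y, max ((if y ∈ B then 1 else 0) / (B.card : ℝ) - (if y ∈ B' then 1 else 0) / (B'.card : ℝ)) 0
      ≤ 1 / (m : ℝ) := by
  have hm' : (0 : ℝ) < m := by exact_mod_cast hm
  have hone : ∀ C : Finset X, 0 < C.card → ∑ y, (if y ∈ C then 1 else 0) / (C.card : ℝ) = 1 := by
    intro C hC
    rw [← Finset.sum_div, Finset.sum_ite_mem, Finset.univ_inter, Finset.sum_const, nsmul_eq_mul,
      mul_one, div_self (by exact_mod_cast hC.ne')]
  wlog hle : B'.card ≤ B.card generalizing B B'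
  · rw [sum_max_sub_comm (by rw [hone B (by lia), hone B' (by lia)])]
    exact this hB' hB h' h (by lia)
  have hBm : (m : ℝ) ≤ B.card := by exact_mod_cast hB
  have hBm' : (m : ℝ) ≤ B'.card := by exact_mod_cast hB'
  have hle' : (B'.card : ℝ) ≤ B.card := by exact_mod_cast hle
  calc _ ≤ ∑ y, if y ∈ B \ B' then 1 / (m : ℝ) else 0 := by
        refine Finset.sum_le_sum fun y _ => ?_
        by_cases hy : y ∈ B <;> by_cases hy' : y ∈ B'
        · simp only [hy, hy', Finset.mem_sdiff, if_true, not_true, and_false, if_false]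
          refine max_le (sub_nonpos.2 ?_) le_rfl
          exact one_div_le_one_div_of_le (by linarith) hle'
        · simp only [hy, hy', Finset.mem_sdiff, if_true, not_false_eq_true, and_true, if_false,
            zero_div, sub_zero]
          exact max_le (one_div_le_one_div_of_le hm' hBm) (by positivity)
        · simp [hy, hy']
        · simp [hy, hy']
    _ = (B \ B').card * (1 / (m : ℝ)) := by
        rw [Finset.sum_ite_mem, Finset.univ_inter, Finset.sum_const, nsmul_eq_mul]
    _ ≤ 1 / (m : ℝ) := by
        refine mul_le_of_le_one_left (by positivity) ?_
        exact_mod_cast h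

open scoped Classical in
/-- The colors that do not occur among the neighbors of `i`. -/
noncomputable def availableColors {V : Type*} {k : ℕ} (G : SimpleGraph V) (i : V) (x : V → Fin k) :
    Finset (Fin k) :=
  Finset.univ.filter fun c => ∀ j, G.Adj i j → c ≠ x j

variable {V : Type*} [Fintype V] [DecidableEq V] {G : SimpleGraph V} [DecidableRel G.Adj] {k : ℕ}

omit [DecidableEq V] in
lemma le_card_availableColors_add_degree (i : V) (x : V → Fin k) :
    k ≤ (availableColors G i x).card + G.degree i := by
  have h1 : (availableColors G i x)ᶜ ⊆ (G.neighborFinset i).image x := by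
    intro c hc
    simp only [availableColors, Finset.mem_compl, Finset.mem_filter, Finset.mem_univ, true_and,
      not_forall, ne_eq, not_not] at hc
    obtain ⟨j, hj, hcj⟩ := hc
    exact Finset.mem_image.2 ⟨j, by simpa using hj, hcj.symm⟩
  have h2 := (Finset.card_le_card h1).trans Finset.card_image_le
  rw [Finset.card_compl, Fintype.card_fin, G.card_neighborFinset_eq_degree] at h2
  lia

-- Recoloring `j` can free only its old color `x j`.
omit [Fintype V] [DecidableRel G.Adj] in
lemma card_availableColors_sdiff_le (i j : V) (x : V → Fin k) (c : Fin k) :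
    (availableColors G i (Function.update x j c) \ availableColors G i x).card ≤ 1 := by
  refine (Finset.card_le_card (t := {x j}) fun y hy => ?_).trans (by simp)
  simp only [availableColors, Finset.mem_sdiff, Finset.mem_filter, Finset.mem_univ, true_and,
    not_forall, ne_eq, not_not] at hy
  obtain ⟨h1, l, hl, hyl⟩ := hy
  have h2 := h1 l hl
  by_cases hlj : l = j
  · rw [Finset.mem_singleton, hyl, hlj]
  · rw [Function.update_of_ne hlj] at h2
    exact absurd hyl h2

/-- Greedy coloring: a new vertex always finds a color unused by its neighbors. -/
lemma properColorings_nonempty (h : G.maxDegree < k) : (properColorings G k).Nonempty := by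
  have key : ∀ T : Finset V, ∃ x : V → Fin k, ∀ a ∈ T, ∀ b ∈ T, G.Adj a b → x a ≠ x b := by
    intro T
    induction T using Finset.induction_on with
    | empty => exact ⟨fun _ => ⟨0, by lia⟩, by simp⟩
    | insert v T hv ih =>
      obtain ⟨x, hx⟩ := ih
      have h1 := le_card_availableColors_add_degree (G := G) v x
      have h2 := G.degree_le_maxDegree v
      obtain ⟨c, hc⟩ := Finset.card_pos.1 (show 0 < (availableColors G v x).card by lia)
      simp only [availableColors, Finset.mem_filter, Finset.mem_univ, true_and] at hc
      refine ⟨Function.update x v c, fun a ha b hb hab => ?_⟩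
      by_cases hav : a = v
      · subst hav
        rw [Function.update_self, Function.update_of_ne hab.ne']
        exact hc b hab
      · by_cases hbv : b = v
        · subst hbv
          rw [Function.update_self, Function.update_of_ne hav]
          exact (hc a hab.symm).symm
        · rw [Function.update_of_ne hav, Function.update_of_ne hbv]
          exact hx a (Finset.mem_of_mem_insert_of_ne ha hav) b
            (Finset.mem_of_mem_insert_of_ne hb hbv) hab
  obtain ⟨x, hx⟩ := key Finset.univ
  exact ⟨x, fun a b => hx a (Finset.mem_univ a) b (Finset.mem_univ b)⟩

omit [DecidableRel G.Adj] in
lemma randomColoring_eq_normalized :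
    randomColoring G k = normalized (constraintWeight G (fun a b : Fin k => a ≠ b) 1) := by
  classical
  have h1 : ∀ x : V → Fin k, constraintWeight G (fun a b : Fin k => a ≠ b) 1 x
      = if x ∈ properColorings G k then 1 else 0 := by
    intro x
    rw [constraintWeight]
    simp only [Pi.one_apply, Finset.prod_const_one]
    congr
  ext x
  rw [normalized, randomColoring, Set.indicator_apply]
  simp_rw [h1]
  rw [Finset.sum_boole, Set.ncard_eq_toFinset_card', Set.toFinset]
  split_ifs
  · congr 3
    ext
    simp
  · simp

omit [Fintype V] [DecidableEq V] [DecidableRel G.Adj] in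
lemma constraintKernel_ne (i : V) (x : V → Fin k) (y : Fin k) :
    constraintKernel G (fun a b : Fin k => a ≠ b) 1 i x y
      = (if y ∈ availableColors G i x then 1 else 0) / ((availableColors G i x).card : ℝ) := by
  have h1 : ∀ y, constraintSiteWeight G (fun a b : Fin k => a ≠ b) 1 i x y
      = if y ∈ availableColors G i x then 1 else 0 := by
    intro y
    simp only [constraintSiteWeight, availableColors, Finset.mem_filter, Finset.mem_univ, true_and,
      Pi.one_apply]
    congr 1
    simp
  rw [constraintKernel, normalizedKernel]
  simp_rw [h1]
  rw [Finset.sum_ite_mem, Finset.univ_inter, Finset.sum_const, nsmul_eq_mul, mul_one]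

end Coloring

/-- At least `k - Δ ≥ Δ + 1` colors are available at each vertex, so a neighbor has influence at
most `1 / (Δ + 1)` and the row sums are at most `Δ / (Δ + 1) < 1`. -/
theorem exists_satisfiesLSI_randomColoring (Δ k : ℕ) (hk : 2 * Δ + 1 ≤ k) :
    ∃ σ2 : ℝ, 0 < σ2 ∧
      ∀ (V : Type*) [Fintype V] [DecidableEq V] (G : SimpleGraph V) [DecidableRel G.Adj],
        G.maxDegree ≤ Δ → SatisfiesLSI (randomColoring G k) σ2 := by
  have hk0 : (0 : ℝ) < k := by exact_mod_cast (show 0 < k by lia)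
  have ht1 : (Δ : ℝ) * (1 / ((Δ + 1 : ℕ) : ℝ)) < 1 := by
    push_cast
    rw [mul_one_div, div_lt_one (by positivity)]
    linarith
  have hα : 0 < 1 - (Δ : ℝ) * (1 / ((Δ + 1 : ℕ) : ℝ)) := by linarith
  refine ⟨2 / ((1 / 2) ^ Δ * (1 / (k : ℝ)) * (1 - (Δ : ℝ) * (1 / ((Δ + 1 : ℕ) : ℝ))) ^ 2),
    by positivity, ?_⟩
  intro V _ _ G _ hΔ
  have : Nonempty (Fin k) := ⟨⟨0, by lia⟩⟩
  have hcard : ∀ i (x : V → Fin k), Δ + 1 ≤ (availableColors G i x).card := by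
    intro i x
    have h1 := le_card_availableColors_add_degree (G := G) i x
    have h2 := G.degree_le_maxDegree i
    lia
  have hcard' : ∀ i (x : V → Fin k), ((availableColors G i x).card : ℝ) ≤ k := by
    intro i x
    exact_mod_cast (Finset.card_le_univ _).trans_eq (Fintype.card_fin k)
  have hnn : ∀ x : V → Fin k, 0 ≤ constraintWeight G (fun a b : Fin k => a ≠ b) 1 x := by
    intro x
    rw [constraintWeight]
    split_ifs <;> simp
  have hpos : ∀ i (x : V → Fin k),
      0 < ∑ y, constraintSiteWeight G (fun a b : Fin k => a ≠ b) 1 i x y := by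
    intro i x
    obtain ⟨c, hc⟩ := Finset.card_pos.1 ((Nat.succ_pos _).trans_le (hcard i x))
    refine Finset.sum_pos' (fun y _ => ?_) ⟨c, Finset.mem_univ _, ?_⟩
    · rw [constraintSiteWeight]
      split_ifs <;> simp
    · rw [constraintSiteWeight, if_pos (by simpa [availableColors] using hc)]
      simp
  have hle : ∀ i (x : V → Fin k) y,
      constraintKernel G (fun a b : Fin k => a ≠ b) 1 i x y ≤ 1 / ((Δ + 1 : ℕ) : ℝ) := by
    intro i x y
    rw [constraintKernel_ne]
    have h1 : ((Δ + 1 : ℕ) : ℝ) ≤ (availableColors G i x).card := by exact_mod_cast hcard i x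
    have h2 : (0 : ℝ) < ((Δ + 1 : ℕ) : ℝ) := by positivity
    split_ifs
    · exact one_div_le_one_div_of_le h2 h1
    · rw [zero_div]
      positivity
  rw [randomColoring_eq_normalized]
  refine satisfiesLSI_constraint (q := 1) hΔ (fun a b h => h.symm) (fun _ => zero_le_one) ?_ hpos ?_
    (by positivity) ht1 (by norm_num) (by norm_num) (by positivity) ?_ ?_
  · obtain ⟨x, hx⟩ := properColorings_nonempty (G := G) (k := k) (by lia)
    refine Finset.sum_pos' (fun x _ => hnn x) ⟨x, Finset.mem_univ _, ?_⟩
    unfold constraintWeight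
    exact zero_lt_one.trans_eq ((if_pos hx).trans (by simp)).symm
  · intro i j x c _
    simp_rw [constraintKernel_ne]
    refine sum_max_uniform_sub_le (Nat.succ_pos Δ) (hcard _ _) (hcard _ _)
      (card_availableColors_sdiff_le i j x c) ?_
    have := card_availableColors_sdiff_le (G := G) i j (Function.update x j c) (x j)
    rwa [Function.update_idem, Function.update_eq_self] at this
  · intro y i j x hij
    -- An edge exists, hence `Δ ≥ 1` and a given color has probability at most 1/2 at `j`. This is
    -- the source of `r = 1 / 2`.
    have h1 : 1 ≤ Δ := by
      have h2 : 0 < G.degree i := (G.degree_pos_iff_exists_adj i).2 ⟨j, hij⟩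
      have h3 := G.degree_le_maxDegree i
      lia
    have h4 : ∑ c, constraintKernel G (fun a b : Fin k => a ≠ b) 1 j x c = 1 := by
      simp only [constraintKernel, normalizedKernel]
      rw [← Finset.sum_div, div_self (hpos j x).ne']
    rw [← Finset.sum_erase_add _ _ (Finset.mem_univ y), if_neg (by simp), add_zero]
    refine le_of_le_of_eq ?_
      (Finset.sum_congr rfl fun c hc => (if_pos (Finset.ne_of_mem_erase hc).symm).symm)
    rw [← Finset.sum_erase_add _ _ (Finset.mem_univ y)] at h4
    have h5 : 1 / ((Δ + 1 : ℕ) : ℝ) ≤ 1 / 2 :=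
      one_div_le_one_div_of_le two_pos (by exact_mod_cast (show 2 ≤ Δ + 1 by lia))
    have h6 := hle j x y
    linarith
  · refine fun y => Or.inr fun i x hx => ?_
    rw [constraintKernel_ne, if_pos (by simpa [availableColors] using hx)]
    refine one_div_le_one_div_of_le ?_ (hcard' i x)
    exact_mod_cast (Nat.succ_pos _).trans_le (hcard i x)

/-! ### Gibbs measures, and a crude inequality for a fixed Hamiltonian -/

section Gibbs

variable {ι X : Type*} [Fintype ι] [DecidableEq ι] [Fintype X]

/-- The heat-bath kernels of the Gibbs measure of `H`. -/
noncomputable abbrev gibbsKernel {ι X : Type*} [DecidableEq ι] [Fintype X] (H : (ι → X) → ℝ) :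
    ι → (ι → X) → X → ℝ :=
  normalizedKernel fun i x y => Real.exp (H (Function.update x i y))

omit [Fintype ι] in
lemma isSiteKernel_gibbsKernel [Nonempty X] (H : (ι → X) → ℝ) : IsSiteKernel (gibbsKernel H) :=
  isSiteKernel_normalizedKernel (fun _ _ _ => (Real.exp_pos _).le)
    (fun _ _ => Finset.sum_pos (fun _ _ => Real.exp_pos _) Finset.univ_nonempty)
    (fun _ _ _ => by simp)

lemma isSpinSystem_gibbs [Nonempty X] (H : (ι → X) → ℝ) : IsSpinSystem (gibbs H) :=
  isSpinSystem_normalized (fun _ => (Real.exp_pos _).le)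
    (Finset.sum_pos (fun _ _ => Real.exp_pos _) Finset.univ_nonempty)

lemma detailedBalance_gibbs (H : (ι → X) → ℝ) (S : Finset ι) :
    DetailedBalance (gibbsKernel H) S (gibbs H) :=
  detailedBalance_normalized (fun _ _ => 1) (fun _ _ _ => (one_mul _).symm) S

lemma gibbs_pos [Nonempty X] (H : (ι → X) → ℝ) (x : ι → X) : 0 < gibbs H x :=
  div_pos (Real.exp_pos _) (Finset.sum_pos (fun _ _ => Real.exp_pos _) Finset.univ_nonempty)

omit [Fintype ι] in
lemma gibbsKernel_pos [Nonempty X] (H : (ι → X) → ℝ) (i : ι) (x : ι → X) (y : X) :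
    0 < gibbsKernel H i x y :=
  div_pos (Real.exp_pos _) (Finset.sum_pos (fun _ _ => Real.exp_pos _) Finset.univ_nonempty)

lemma mul_log_sub_nonneg {a t : ℝ} (ha : 0 ≤ a) (ht : 0 < t) :
    0 ≤ a * Real.log a - a * Real.log t - a + t := by
  rcases ha.eq_or_lt with h | h
  · simp [← h, ht.le]
  · have h1 := Real.log_le_sub_one_of_pos (div_pos ht h)
    rw [Real.log_div ht.ne' h.ne'] at h1
    have h2 := mul_le_mul_of_nonneg_left h1 ha
    have h3 : a * (t / a - 1) = t - a := by field_simp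
    nlinarith

/-- The comparison of entropies of Holley and Stroock. -/
lemma entropy_sq_le_of_le {μ ν : (ι → X) → ℝ} (hμ : IsSpinSystem μ) (hν : IsSpinSystem ν) {c : ℝ}
    (h : ∀ x, μ x ≤ c * ν x) (g : (ι → X) → ℝ) :
    entropy μ (fun x => g x ^ 2) ≤ c * entropy ν (fun x => g x ^ 2) := by
  have hm0 : 0 ≤ expect μ (fun x => g x ^ 2) :=
    Finset.sum_nonneg fun x _ => mul_nonneg (hμ.1 x) (sq_nonneg _)
  have ht0 : 0 ≤ expect ν (fun x => g x ^ 2) :=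
    Finset.sum_nonneg fun x _ => mul_nonneg (hν.1 x) (sq_nonneg _)
  rcases ht0.eq_or_lt with ht | ht
  · have hm : expect μ (fun x => g x ^ 2) = 0 := by
      refine le_antisymm ?_ hm0
      calc _ ≤ c * expect ν (fun x => g x ^ 2) := by
            rw [expect, expect, Finset.mul_sum]
            refine Finset.sum_le_sum fun x _ => ?_
            rw [← mul_assoc]
            exact mul_le_mul_of_nonneg_right (h x) (sq_nonneg _)
        _ = 0 := by rw [← ht, mul_zero]
    rw [entropy_sq_eq_zero hμ.1 hm, entropy_sq_eq_zero hν.1 ht.symm, mul_zero]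
  set t := expect ν (fun x => g x ^ 2) with htd
  set m := expect μ (fun x => g x ^ 2) with hmd
  have key : ∀ ρ : (ι → X) → ℝ, ∑ x, ρ x = 1 →
      ∑ x, ρ x * (g x ^ 2 * Real.log (g x ^ 2) - g x ^ 2 * Real.log t - g x ^ 2 + t)
        = expect ρ (fun x => g x ^ 2 * Real.log (g x ^ 2))
          - expect ρ (fun x => g x ^ 2) * Real.log t - expect ρ (fun x => g x ^ 2) + t := by
    intro ρ hρ
    simp only [expect, mul_add, mul_sub, Finset.sum_add_distrib, Finset.sum_sub_distrib]
    rw [← Finset.sum_mul, hρ, one_mul, Finset.sum_mul]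
    simp only [mul_assoc]
  -- Replacing the mean of g² under μ by its mean `t` under ν can only increase the expression, and
  -- it makes the integrand nonnegative, so the densities can be compared pointwise.
  calc entropy μ (fun x => g x ^ 2)
      ≤ ∑ x, μ x * (g x ^ 2 * Real.log (g x ^ 2) - g x ^ 2 * Real.log t - g x ^ 2 + t) := by
        rw [key μ hμ.2, entropy, ← hmd]
        linarith [mul_log_sub_nonneg hm0 ht]
    _ ≤ ∑ x, c * ν x * (g x ^ 2 * Real.log (g x ^ 2) - g x ^ 2 * Real.log t - g x ^ 2 + t) :=
        Finset.sum_le_sum fun x _ =>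
          mul_le_mul_of_nonneg_right (h x) (mul_log_sub_nonneg (sq_nonneg _) ht)
    _ = c * entropy ν (fun x => g x ^ 2) := by
        simp_rw [mul_assoc c]
        rw [← Finset.mul_sum, key ν hν.2, entropy, ← htd]
        ring

/-- Every fixed Gibbs measure satisfies a logarithmic Sobolev inequality. -/
theorem exists_satisfiesLSI_gibbs [DecidableEq X] [Nonempty X] (H : (ι → X) → ℝ) :
    ∃ σ2 : ℝ, 0 < σ2 ∧ SatisfiesLSI (gibbs H) σ2 := by
  set μ := gibbs H
  -- The uniform product measure has zero influence matrix and explicit marginals, so the general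
  -- criterion applies to it.
  set ν : (ι → X) → ℝ := gibbs fun _ => 0
  have hμ : IsSpinSystem μ := isSpinSystem_gibbs H
  have hν : IsSpinSystem ν := isSpinSystem_gibbs _
  have hK := isSiteKernel_gibbsKernel H
  have hK' := isSiteKernel_gibbsKernel (fun _ : ι → X => (0 : ℝ))
  have hX : (0 : ℝ) < Fintype.card X := by exact_mod_cast Fintype.card_pos
  have hkernel : ∀ i (x : ι → X) y,
      gibbsKernel (fun _ : ι → X => (0 : ℝ)) i x y = 1 / (Fintype.card X : ℝ) := by
    intro i x y
    simp [gibbsKernel, normalizedKernel]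
  have hle : ∀ {ρ : (ι → X) → ℝ}, IsSpinSystem ρ → ∀ x, ρ x ≤ 1 := fun hρ x => by
    rw [← hρ.2]
    exact Finset.single_le_sum (fun x _ => hρ.1 x) (Finset.mem_univ x)
  have hle' : ∀ i (x : ι → X) y, gibbsKernel (fun _ : ι → X => (0 : ℝ)) i x y ≤ 1 := by
    intro i x y
    rw [← hK'.sum_eq_one i x]
    exact Finset.single_le_sum (fun y _ => hK'.nonneg i x y) (Finset.mem_univ y)
  set c : ℝ := ∑ x, (ν x)⁻¹
  -- A sum of inverses dominates each of them, which is all the comparison needs; the summand 1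
  -- keeps `d` positive when there are no sites.
  set d : ℝ := 1 + ∑ i, ∑ x, ∑ y, (μ x * gibbsKernel H i x y)⁻¹
  have hc0 : 0 < c := Finset.sum_pos (fun x _ => inv_pos.2 (gibbs_pos _ x)) Finset.univ_nonempty
  have hpos : ∀ i x y, 0 < μ x * gibbsKernel H i x y := fun i x y =>
    mul_pos (gibbs_pos _ _) (gibbsKernel_pos _ _ _ _)
  have hd0 : 0 < d := add_pos_of_pos_of_nonneg one_pos <| Finset.sum_nonneg fun i _ =>
    Finset.sum_nonneg fun x _ => Finset.sum_nonneg fun y _ => (inv_pos.2 (hpos i x y)).le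
  have hc : ∀ x, μ x ≤ c * ν x := by
    intro x
    calc μ x ≤ 1 := hle hμ x
      _ = (ν x)⁻¹ * ν x := (inv_mul_cancel₀ (gibbs_pos _ x).ne').symm
      _ ≤ c * ν x := mul_le_mul_of_nonneg_right
          (Finset.single_le_sum (f := fun x => (ν x)⁻¹) (fun x _ => inv_nonneg.2 (hν.1 x))
            (Finset.mem_univ x)) (hν.1 x)
  have hd : ∀ i x y, ν x * gibbsKernel (fun _ : ι → X => (0 : ℝ)) i x y
      ≤ d * (μ x * gibbsKernel H i x y) := by
    intro i x y
    have h1 : (μ x * gibbsKernel H i x y)⁻¹ ≤ d := by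
      have h2 := Finset.single_le_sum (f := fun y => (μ x * gibbsKernel H i x y)⁻¹)
        (fun y _ => (inv_pos.2 (hpos i x y)).le) (Finset.mem_univ y)
      have h3 := Finset.single_le_sum (f := fun x => ∑ y, (μ x * gibbsKernel H i x y)⁻¹)
        (fun x _ => Finset.sum_nonneg fun y _ => (inv_pos.2 (hpos i x y)).le) (Finset.mem_univ x)
      have h4 := Finset.single_le_sum (f := fun i => ∑ x, ∑ y, (μ x * gibbsKernel H i x y)⁻¹)
        (fun i _ => Finset.sum_nonneg fun x _ => Finset.sum_nonneg fun y _ =>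
          (inv_pos.2 (hpos i x y)).le) (Finset.mem_univ i)
      linarith
    calc _ ≤ 1 := mul_le_one₀ (hle hν x) (hK'.nonneg i x y) (hle' i x y)
      _ = (μ x * gibbsKernel H i x y)⁻¹ * (μ x * gibbsKernel H i x y) :=
          (inv_mul_cancel₀ (hpos i x y).ne').symm
      _ ≤ _ := mul_le_mul_of_nonneg_right h1 (hpos i x y).le
  set β : ℝ := 1 / (Fintype.card X : ℝ) with hβ
  refine ⟨c * (2 / β) * d, by positivity, hμ, fun g => ?_⟩
  have h1 : entropy ν (fun x => g x ^ 2)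
      ≤ 2 / (β * (1 - 0) ^ 2) * ∑ i, siteForm (gibbsKernel fun _ => 0) ν i g :=
    entropy_sq_le_of_influence hK' (A := fun _ _ => 0) (fun i j x c => by simp [hkernel])
      zero_lt_one (by simp) (by simp) (by positivity)
      (hasMarginalBound_of_le hK' fun i x y => (hkernel i x y).ge) hν
      (detailedBalance_gibbs _ _) isPinnedOff_univ g
  have h2 : ∑ i, siteForm (gibbsKernel fun _ => 0) ν i g
      ≤ d * ∑ i, siteForm (gibbsKernel H) μ i g := by
    rw [Finset.mul_sum]
    refine Finset.sum_le_sum fun i _ => ?_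
    simp only [siteForm, Finset.mul_sum]
    refine Finset.sum_le_sum fun x _ => Finset.sum_le_sum fun y _ => ?_
    rw [← mul_assoc]
    exact mul_le_mul_of_nonneg_right (hd i x y) (sq_nonneg _)
  rw [sub_zero, one_pow, mul_one] at h1
  calc _ ≤ c * entropy ν (fun x => g x ^ 2) := entropy_sq_le_of_le hμ hν hc g
    _ ≤ c * (2 / β * (d * ∑ i, siteForm (gibbsKernel H) μ i g)) :=
        mul_le_mul_of_nonneg_left (h1.trans (mul_le_mul_of_nonneg_left h2 (by positivity))) hc0.le
    _ = _ := by
        rw [sum_siteForm_eq hK hμ (detailedBalance_gibbs H _)]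
        ring

end Gibbs

/-! ### Binary Gibbs measures and Hamiltonians made of monomials -/

section BinaryGibbs

variable {ι : Type*} [Fintype ι] [DecidableEq ι]

/-- The increment of `H` when the spin at `i` is switched on. -/
def increment {ι : Type*} [DecidableEq ι] (H : (ι → Fin 2) → ℝ) (i : ι) (x : ι → Fin 2) : ℝ :=
  H (Function.update x i 1) - H (Function.update x i 0)

omit [Fintype ι] in
lemma gibbsKernel_one (H : (ι → Fin 2) → ℝ) (i : ι) (x : ι → Fin 2) :
    gibbsKernel H i x 1 = Real.sigmoid (increment H i x) := by
  rw [gibbsKernel, normalizedKernel, Fin.sum_univ_two, Real.sigmoid_def, increment, neg_sub,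
    Real.exp_sub, ← one_div]
  have h1 := Real.exp_pos (H (Function.update x i 1))
  have h0 := Real.exp_pos (H (Function.update x i 0))
  field_simp
  ring

/-- The logarithmic Sobolev inequality for binary Gibbs measures with weak dependencies. -/
theorem satisfiesLSI_gibbs_of_increment (H : (ι → Fin 2) → ℝ) {A : ι → ι → ℝ} {α M : ℝ}
    (hα : α < 1) (hA0 : ∀ i j, 0 ≤ A i j) (hsymm : ∀ i j, A i j = A j i)
    (hrow : ∀ i, ∑ j, A i j ≤ α)
    (hA : ∀ i j x c, i ≠ j → |Real.sigmoid (increment H i (Function.update x j c))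
      - Real.sigmoid (increment H i x)| ≤ A i j)
    (hM : ∀ i x, |increment H i x| ≤ M) :
    SatisfiesLSI (gibbs H) (2 / (Real.sigmoid (-M) * (1 - α) ^ 2)) := by
  have hK := isSiteKernel_gibbsKernel H
  have hK0 : ∀ i x, gibbsKernel H i x 0 = Real.sigmoid (-increment H i x) := by
    intro i x
    have h := hK.sum_eq_one i x
    rw [Fin.sum_univ_two, gibbsKernel_one] at h
    rw [Real.sigmoid_neg]
    linarith
  refine satisfiesLSI_of_influence hK (A := A) ?_ hα hrow (fun j => ?_) (Real.sigmoid_pos _)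
    (hasMarginalBound_of_le hK fun i x y => ?_) (isSpinSystem_gibbs H) (detailedBalance_gibbs H _)
  · intro i j x c
    rw [sum_max_sub_fin_two ((hK.sum_eq_one _ _).trans (hK.sum_eq_one _ _).symm)]
    by_cases hij : i = j
    · subst hij
      simp only [hK.update_eq, sub_self, abs_zero]
      exact hA0 i i
    · simp only [gibbsKernel_one]
      exact hA i j x c hij
  · simp_rw [fun i => hsymm i j]
    exact hrow j
  · have h := abs_le.1 (hM i x)
    fin_cases y
    · exact (Real.sigmoid_le (by linarith)).trans_eq (hK0 i x).symm
    · exact (Real.sigmoid_le h.1).trans_eq (gibbsKernel_one H i x).symm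

lemma sigmoid_mul_one_sub_mem (x : ℝ) :
    0 ≤ Real.sigmoid x * (1 - Real.sigmoid x) ∧ Real.sigmoid x * (1 - Real.sigmoid x) ≤ 1 / 4 :=
  ⟨mul_nonneg (Real.sigmoid_nonneg x) (sub_nonneg.2 (Real.sigmoid_le_one x)), by
    nlinarith [sq_nonneg (Real.sigmoid x - 1 / 2)]⟩

lemma abs_sigmoid_sub_le (a b : ℝ) : |Real.sigmoid a - Real.sigmoid b| ≤ 1 / 4 * |a - b| := by
  have := Convex.norm_image_sub_le_of_norm_deriv_le (f := Real.sigmoid) (C := 1 / 4)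
    (s := Set.univ) (x := b) (y := a) (fun x _ => differentiable_sigmoid x) (fun x _ => by
      have h := sigmoid_mul_one_sub_mem x
      rw [Real.deriv_sigmoid, Real.norm_eq_abs, abs_of_nonneg h.1]
      exact h.2) convex_univ (Set.mem_univ _) (Set.mem_univ _)
  simpa only [Real.norm_eq_abs] using this

/-- A Hamiltonian that is a linear combination of monomials in the spins. -/
def monomialSum {ι Φ : Type*} [DecidableEq ι] [Fintype Φ] (w : Φ → ℝ) (T : Φ → Finset ι)
    (x : ι → Fin 2) : ℝ :=
  ∑ φ, w φ * if ∀ e ∈ T φ, x e = 1 then 1 else 0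

variable {Φ : Type*} [Fintype Φ] {w : Φ → ℝ} {T : Φ → Finset ι}

lemma increment_monomialSum (e : ι) (x : ι → Fin 2) :
    increment (monomialSum w T) e x
      = ∑ φ, if e ∈ T φ then w φ * (if ∀ f ∈ T φ, f ≠ e → x f = 1 then 1 else 0) else 0 := by
  rw [increment, monomialSum, monomialSum, ← Finset.sum_sub_distrib]
  refine Finset.sum_congr rfl fun φ _ => ?_
  by_cases he : e ∈ T φ
  · have h1 : (∀ f ∈ T φ, Function.update x e 1 f = 1) ↔ ∀ f ∈ T φ, f ≠ e → x f = 1 := by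
      refine forall₂_congr fun f _ => ?_
      by_cases hf : f = e
      · subst hf; simp
      · simp [hf]
    have h2 : ¬ ∀ f ∈ T φ, Function.update x e 0 f = 1 := fun h => by simpa using h e he
    simp only [h1, h2, if_false, mul_zero, sub_zero, he, if_true]
  · have h1 : ∀ c, (∀ f ∈ T φ, Function.update x e c f = 1) ↔ ∀ f ∈ T φ, x f = 1 := by
      refine fun c => forall₂_congr fun f hf => ?_
      rw [Function.update_of_ne (by rintro rfl; exact he hf)]
    simp only [h1, sub_self, he, if_false]

lemma abs_increment_monomialSum_le (e : ι) (x : ι → Fin 2) :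
    |increment (monomialSum w T) e x| ≤ ∑ φ, if e ∈ T φ then |w φ| else 0 := by
  rw [increment_monomialSum]
  refine (Finset.abs_sum_le_sum_abs _ _).trans (Finset.sum_le_sum fun φ _ => ?_)
  split_ifs <;> simp

lemma abs_increment_monomialSum_sub_le {e f : ι} (x : ι → Fin 2) (c : Fin 2) :
    |increment (monomialSum w T) e (Function.update x f c) - increment (monomialSum w T) e x|
      ≤ ∑ φ, if e ∈ T φ ∧ f ∈ T φ then |w φ| else 0 := by
  rw [increment_monomialSum, increment_monomialSum, ← Finset.sum_sub_distrib]
  refine (Finset.abs_sum_le_sum_abs _ _).trans (Finset.sum_le_sum fun φ _ => ?_)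
  by_cases hf : f ∈ T φ
  · by_cases he : e ∈ T φ
    · simp only [he, hf, and_self, if_true]
      rw [← mul_sub, abs_mul]
      refine mul_le_of_le_one_right (abs_nonneg _) ?_
      split_ifs <;> simp
    · simp [he]
  · have h1 : (∀ l ∈ T φ, l ≠ e → Function.update x f c l = 1)
        ↔ ∀ l ∈ T φ, l ≠ e → x l = 1 := by
      refine forall₂_congr fun l hl => ?_
      rw [Function.update_of_ne (by rintro rfl; exact hf hl)]
    simp only [h1, sub_self, abs_zero]
    split_ifs <;> simp

/-- The spin at `f` affects the increment at `e` only through monomials containing both. Summing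
over `f ≠ e` counts a monomial through `e` exactly `(T φ).card - 1` times; 1/4 is the Lipschitz
constant of the sigmoid. -/
theorem satisfiesLSI_gibbs_monomialSum {α M : ℝ} (hα : α < 1)
    (hM : ∀ e, ∑ φ, (if e ∈ T φ then |w φ| else 0) ≤ M)
    (hrow : ∀ e, 1 / 4 * ∑ φ, (if e ∈ T φ then |w φ| * ((T φ).card - 1) else 0) ≤ α) :
    SatisfiesLSI (gibbs (monomialSum w T)) (2 / (Real.sigmoid (-M) * (1 - α) ^ 2)) := by
  refine satisfiesLSI_gibbs_of_increment _ hα (A := fun e f => if e = f then 0 else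
    1 / 4 * ∑ φ, if e ∈ T φ ∧ f ∈ T φ then |w φ| else 0) ?_ ?_ ?_ ?_
    (fun e x => (abs_increment_monomialSum_le e x).trans (hM e))
  · intro e f
    split_ifs
    · rfl
    · exact mul_nonneg (by norm_num) (Finset.sum_nonneg fun φ _ => by split_ifs <;> simp)
  · intro e f
    simp_rw [eq_comm (a := e), and_comm]
  · intro e
    refine le_trans (le_of_eq ?_) (hrow e)
    rw [← Finset.sum_erase_add _ _ (Finset.mem_univ e), if_pos rfl, add_zero,
      Finset.sum_congr rfl fun f hf => if_neg (Finset.ne_of_mem_erase hf).symm, ← Finset.mul_sum,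
      Finset.sum_comm]
    congr 1
    refine Finset.sum_congr rfl fun φ _ => ?_
    split_ifs with he
    · simp only [he, true_and]
      rw [Finset.sum_ite_mem, Finset.erase_inter, Finset.univ_inter, Finset.sum_const,
        Finset.card_erase_of_mem he, nsmul_eq_mul, Nat.cast_pred (Finset.card_pos.2 ⟨e, he⟩),
        mul_comm]
    · simp [he]
  · intro e f x c hef
    rw [if_neg hef]
    exact (abs_sigmoid_sub_le _ _).trans
      (mul_le_mul_of_nonneg_left (abs_increment_monomialSum_sub_le x c) (by norm_num))

end BinaryGibbs

/-! ### The exponential random graph model -/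

section ERGM

open scoped Classical in
/-- The edges of the image of the graph `G` under `φ`. -/
noncomputable def imageEdges {V : Type*} {n : ℕ} (G : SimpleGraph V) (φ : V → Fin n) :
    Finset (EdgeSite n) :=
  Finset.univ.filter fun e => ∃ a b, G.Adj a b ∧ φ a = e.1.1 ∧ φ b = e.1.2

lemma mem_imageEdges {V : Type*} {n : ℕ} {G : SimpleGraph V} {φ : V → Fin n} {e : EdgeSite n} :
    e ∈ imageEdges G φ ↔ ∃ a b, G.Adj a b ∧ φ a = e.1.1 ∧ φ b = e.1.2 := by
  simp [imageEdges]

lemma forall_adj_graphOf_iff {V : Type*} {n : ℕ} {G : SimpleGraph V} {φ : V → Fin n}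
    (hφ : Function.Injective φ) (x : EdgeSite n → Fin 2) :
    (∀ a b, G.Adj a b → (graphOf x).Adj (φ a) (φ b)) ↔ ∀ e ∈ imageEdges G φ, x e = 1 := by
  constructor
  · intro h e he
    obtain ⟨a, b, hab, ha, hb⟩ := mem_imageEdges.1 he
    have h1 := h a b hab
    rw [ha, hb, graphOf, SimpleGraph.fromRel_adj] at h1
    rcases h1.2 with ⟨_, h2⟩ | ⟨h2, _⟩
    · exact h2
    · exact absurd h2 e.2.asymm
  · intro h a b hab
    have hne : φ a ≠ φ b := fun h' => hab.ne (hφ h')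
    rw [graphOf, SimpleGraph.fromRel_adj]
    refine ⟨hne, ?_⟩
    rcases hne.lt_or_gt with hlt | hlt
    · exact Or.inl ⟨hlt, h ⟨(φ a, φ b), hlt⟩ (mem_imageEdges.2 ⟨a, b, hab, rfl, rfl⟩)⟩
    · exact Or.inr ⟨hlt, h ⟨(φ b, φ a), hlt⟩ (mem_imageEdges.2 ⟨b, a, hab.symm, rfl, rfl⟩)⟩

lemma card_imageEdges_le {V : Type*} [Fintype V] {n : ℕ} (G : SimpleGraph V) (φ : V → Fin n) :
    (imageEdges G φ).card ≤ Nat.card G.edgeSet := by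
  classical
  rw [Nat.card_eq_fintype_card, ← SimpleGraph.edgeFinset_card]
  refine le_trans ?_ (Finset.card_image_le (s := G.edgeFinset) (f := Sym2.map φ))
  refine Finset.card_le_card_of_injOn (fun e => s(e.1.1, e.1.2)) (fun e he => ?_) ?_
  · obtain ⟨a, b, hab, ha, hb⟩ := mem_imageEdges.1 he
    rw [Finset.mem_coe, Finset.mem_image]
    exact ⟨s(a, b), by simpa using hab, by simp [ha, hb]⟩
  · rintro ⟨⟨a, b⟩, h⟩ - ⟨⟨c, d⟩, h'⟩ - heq
    simp only [Sym2.eq_iff] at heq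
    rcases heq with ⟨rfl, rfl⟩ | ⟨rfl, rfl⟩
    · rfl
    · exact absurd h h'.asymm

/-- Overwriting the two prescribed values by an arbitrary pair is injective. The product form avoids
the exponent `card V - 2`. -/
lemma card_filter_two_values_mul_le {V : Type*} [Fintype V] [DecidableEq V] {n : ℕ} {p q : V}
    (hpq : p ≠ q) (a b : Fin n) :
    (Finset.univ.filter fun φ : V → Fin n => φ p = a ∧ φ q = b).card * n ^ 2
      ≤ n ^ Fintype.card V := by
  have h1 : n ^ Fintype.card V = (Finset.univ : Finset (V → Fin n)).card := by simp
  have h2 : n ^ 2 = (Finset.univ : Finset (Fin n × Fin n)).card := by simp [sq]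
  rw [h1, h2, ← Finset.card_product]
  refine Finset.card_le_card_of_injOn
    (fun z => Function.update (Function.update z.1 p z.2.1) q z.2.2) (by simp) ?_
  rintro ⟨φ, c, d⟩ hφ ⟨ψ, c', d'⟩ hψ heq
  simp only [Finset.coe_product, Finset.coe_filter, Finset.mem_univ, true_and, Finset.coe_univ,
    Set.mem_prod, Set.mem_ofPred_eq, Set.mem_univ, and_true] at hφ hψ
  have hd : d = d' := by simpa using congrFun heq q
  have hc : c = c' := by simpa [hpq] using congrFun heq p
  have hfun : φ = ψ := by
    ext1 v
    by_cases hq : v = q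
    · rw [hq, hφ.2, hψ.2]
    · by_cases hp : v = p
      · rw [hp, hφ.1, hψ.1]
      · simpa [hp, hq] using congrFun heq v
  rw [hd, hc, hfun]

-- A map covering `e` sends some dart onto `e` with its orientation; there are twice as many darts
-- as edges.
open scoped Classical in
lemma card_filter_mem_imageEdges_mul_le {V : Type*} [Fintype V] [DecidableEq V] {n : ℕ} (G : SimpleGraph V)
    (e : EdgeSite n) :
    (Finset.univ.filter fun φ : V → Fin n => e ∈ imageEdges G φ).card * n ^ 2
      ≤ 2 * Nat.card G.edgeSet * n ^ Fintype.card V := by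
  rw [Nat.card_eq_fintype_card, ← SimpleGraph.edgeFinset_card,
    ← SimpleGraph.dart_card_eq_twice_card_edges]
  have h1 : (Finset.univ.filter fun φ : V → Fin n => e ∈ imageEdges G φ) ⊆
      Finset.univ.biUnion fun d : G.Dart =>
        Finset.univ.filter fun φ : V → Fin n => φ d.fst = e.1.1 ∧ φ d.snd = e.1.2 := by
    intro φ hφ
    obtain ⟨a, b, hab, ha, hb⟩ := mem_imageEdges.1 (Finset.mem_filter.1 hφ).2
    simp only [Finset.mem_biUnion, Finset.mem_univ, Finset.mem_filter, true_and]
    exact ⟨⟨(a, b), hab⟩, ha, hb⟩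
  calc _ ≤ (∑ d : G.Dart, (Finset.univ.filter fun φ : V → Fin n =>
          φ d.fst = e.1.1 ∧ φ d.snd = e.1.2).card) * n ^ 2 :=
        Nat.mul_le_mul_right _ ((Finset.card_le_card h1).trans Finset.card_biUnion_le)
    _ ≤ ∑ d : G.Dart, n ^ Fintype.card V := by
        rw [Finset.sum_mul]
        exact Finset.sum_le_sum fun d _ => card_filter_two_values_mul_le d.adj.ne _ _
    _ = _ := by rw [Finset.sum_const, smul_eq_mul, Finset.card_univ]

open scoped Classical in
/-- The coefficient of a map in the expansion of the Hamiltonian into monomials. -/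
noncomputable def ergmCoeff {s : ℕ} (v : Fin s → ℕ) (β : Fin s → ℝ) (n : ℕ)
    (φ : Σ i : Fin s, Fin (v i) → Fin n) : ℝ :=
  if Function.Injective φ.2 then (n : ℝ) ^ 2 * (β φ.1 / (n : ℝ) ^ v φ.1) else 0

lemma ergmHamiltonian_eq_monomialSum {s : ℕ} {v : Fin s → ℕ}
    (G : (i : Fin s) → SimpleGraph (Fin (v i))) (β : Fin s → ℝ) (n : ℕ) :
    ergmHamiltonian G β n = monomialSum (ergmCoeff v β n) (fun φ => imageEdges (G φ.1) φ.2) := by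
  classical
  ext x
  rw [ergmHamiltonian, monomialSum, Fintype.sum_sigma, Finset.mul_sum]
  refine Finset.sum_congr rfl fun i _ => ?_
  rw [homCount, Nat.card_eq_fintype_card, Fintype.card_subtype, Finset.card_filter,
    Nat.cast_sum, Finset.sum_div, Finset.mul_sum, Finset.mul_sum]
  refine Finset.sum_congr rfl fun φ _ => ?_
  rw [ergmCoeff]
  by_cases hφ : Function.Injective φ
  · by_cases h : ∀ e ∈ imageEdges (G i) φ, x e = 1
    · rw [if_pos ⟨hφ, (forall_adj_graphOf_iff hφ x).2 h⟩, if_pos hφ, if_pos h]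
      push_cast
      ring
    · rw [if_neg fun h' => h ((forall_adj_graphOf_iff hφ x).1 h'.2), if_neg h]
      simp
  · rw [if_neg fun h' => hφ h'.1, if_neg hφ]
    simp

/-- The factor n² / n^v in the coefficients is compensated by the number of maps covering `e`, at
most 2 |E| n^(v - 2); this makes the bound independent of `n`. -/
lemma sum_abs_ergmCoeff_mul_le {s : ℕ} {v : Fin s → ℕ}
    (G : (i : Fin s) → SimpleGraph (Fin (v i))) (β : Fin s → ℝ) (n : ℕ) (e : EdgeSite n)
    (F : (φ : Σ i : Fin s, Fin (v i) → Fin n) → ℝ) (C : Fin s → ℝ)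
    (hF : ∀ φ, e ∈ imageEdges (G φ.1) φ.2 → F φ ≤ C φ.1)
    (hF0 : ∀ φ, e ∈ imageEdges (G φ.1) φ.2 → 0 ≤ F φ) (hC : ∀ i, 0 ≤ C i) :
    ∑ φ, (if e ∈ imageEdges (G φ.1) φ.2 then |ergmCoeff v β n φ| * F φ else 0)
      ≤ ∑ i, |β i| * (2 * Nat.card (G i).edgeSet) * C i := by
  classical
  have hn : (0 : ℝ) < n := by exact_mod_cast e.1.1.pos
  rw [Fintype.sum_sigma]
  refine Finset.sum_le_sum fun i _ => ?_
  set c : ℝ := (n : ℝ) ^ 2 * (|β i| / (n : ℝ) ^ v i) with hc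
  have hc0 : 0 ≤ c := by positivity
  have hcoeff : ∀ φ : Fin (v i) → Fin n, |ergmCoeff v β n ⟨i, φ⟩| ≤ c := by
    intro φ
    rw [ergmCoeff]
    split_ifs
    · rw [abs_mul, abs_div, abs_of_nonneg (by positivity : (0 : ℝ) ≤ (n : ℝ) ^ 2),
        abs_of_nonneg (by positivity : (0 : ℝ) ≤ (n : ℝ) ^ v i)]
    · simpa using hc0
  set m := (Finset.univ.filter fun φ : Fin (v i) → Fin n => e ∈ imageEdges (G i) φ).card with hm
  have hcount : (m : ℝ) * (n : ℝ) ^ 2 ≤ 2 * Nat.card (G i).edgeSet * (n : ℝ) ^ v i := by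
    have := card_filter_mem_imageEdges_mul_le (G i) e
    rw [Fintype.card_fin] at this
    rw [hm]
    exact_mod_cast this
  calc _ ≤ ∑ φ : Fin (v i) → Fin n, if e ∈ imageEdges (G i) φ then c * C i else 0 := by
        refine Finset.sum_le_sum fun φ _ => ?_
        split_ifs with he
        · exact mul_le_mul (hcoeff φ) (hF ⟨i, φ⟩ he) (hF0 ⟨i, φ⟩ he) hc0
        · rfl
    _ = |β i| * (m * (n : ℝ) ^ 2 / (n : ℝ) ^ v i) * C i := by
        rw [← Finset.sum_filter, Finset.sum_const, ← hm, nsmul_eq_mul, hc]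
        ring
    _ ≤ _ := by
        refine mul_le_mul_of_nonneg_right (mul_le_mul_of_nonneg_left ?_ (abs_nonneg _)) (hC i)
        rwa [div_le_iff₀ (by positivity)]

/-- The row sums are at most `1/4 ∑ |β i| * 2 N i * (N i - 1)`, which is half the derivative of
`ergmPhi` at 1. -/
theorem exists_satisfiesLSI_ergm {s : ℕ} {v : Fin s → ℕ}
    (G : (i : Fin s) → SimpleGraph (Fin (v i))) (β : Fin s → ℝ)
    (h : 1 / 2 * deriv (ergmPhi G (fun i => |β i|)) 1 < 1) :
    ∃ σ2 : ℝ, 0 < σ2 ∧ ∀ n : ℕ, SatisfiesLSI (ergm G β n) σ2 := by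
  set N : Fin s → ℕ := fun i => Nat.card (G i).edgeSet with hN
  have hderiv : deriv (ergmPhi G (fun i => |β i|)) 1
      = ∑ i, |β i| * (N i : ℝ) * ((N i - 1 : ℕ) : ℝ) := by
    refine HasDerivAt.deriv ?_
    unfold ergmPhi
    refine HasDerivAt.fun_sum fun i _ => ?_
    have := ((hasDerivAt_pow (N i - 1) (1 : ℝ)).const_mul (|β i| * (N i : ℝ)))
    exact this.congr_deriv (by simp)
  rw [hderiv] at h
  set α : ℝ := 1 / 2 * ∑ i, |β i| * (N i : ℝ) * ((N i - 1 : ℕ) : ℝ) with hα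
  set M : ℝ := ∑ i, |β i| * (2 * (N i : ℝ)) * 1
  have hpos : 0 < 1 - α := sub_pos.2 h
  refine ⟨2 / (Real.sigmoid (-M) * (1 - α) ^ 2),
    div_pos two_pos (mul_pos (Real.sigmoid_pos _) (pow_pos hpos 2)), fun n => ?_⟩
  rw [ergm, ergmHamiltonian_eq_monomialSum]
  refine satisfiesLSI_gibbs_monomialSum h (fun e => ?_) (fun e => ?_)
  · have := sum_abs_ergmCoeff_mul_le G β n e (fun _ => 1) (fun _ => 1) (fun _ _ => le_rfl)
      (fun _ _ => zero_le_one) (fun _ => zero_le_one)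
    exact le_trans (le_of_eq (by simp)) this
  · have := sum_abs_ergmCoeff_mul_le G β n e (fun φ => ((imageEdges (G φ.1) φ.2).card : ℝ) - 1)
      (fun i => ((N i - 1 : ℕ) : ℝ)) ?_ ?_ (fun _ => Nat.cast_nonneg _)
    · refine (mul_le_mul_of_nonneg_left this (by norm_num)).trans (le_of_eq ?_)
      rw [hα, Finset.mul_sum, Finset.mul_sum]
      exact Finset.sum_congr rfl fun i _ => by ring
    · intro φ hφ
      rw [sub_le_iff_le_add]
      have h1 := card_imageEdges_le (G φ.1) φ.2
      have h2 : (imageEdges (G φ.1) φ.2).card ≤ N φ.1 - 1 + 1 := by simp only [hN]; lia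
      exact_mod_cast h2
    · intro φ hφ
      rw [sub_nonneg]
      exact_mod_cast Finset.card_pos.2 ⟨e, hφ⟩

end ERGM

/-! ### The vertex-weighted model -/

section VertexERGM

lemma sq_fin_two (a : Fin 2) : ((a.val : ℝ)) ^ 2 = a.val := by
  fin_cases a <;> simp

/-- The Hamiltonian of the vertex-weighted model as a function of the number of occupied sites. -/
noncomputable def vertexPolynomial (β₁ β₂ p : ℝ) (n : ℕ) (s : ℝ) : ℝ :=
  Real.log (p / (1 - p)) * s + β₁ / n * (s ^ 2 - s) + β₂ / (n : ℝ) ^ 2 * (s ^ 3 - 3 * s ^ 2 + 2 * s)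

lemma sum_pairs_eq {n : ℕ} {y : Fin n → ℝ} (hy : ∀ i, y i ^ 2 = y i) :
    ∑ i, ∑ j, (if i ≠ j then y i * y j else 0) = (∑ i, y i) ^ 2 - ∑ i, y i := by
  have h1 : ∀ i, ∑ j, (if i ≠ j then y i * y j else 0) = y i * ∑ j, y j - y i := by
    intro i
    have h2 : ∀ j, (if i ≠ j then y i * y j else 0) = y i * y j - if i = j then y i else 0 := by
      intro j
      by_cases h : i = j
      · subst h
        simp [← sq, hy]
      · simp [h]
    simp_rw [h2]
    rw [Finset.sum_sub_distrib, Finset.mul_sum]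
    simp
  simp_rw [h1]
  rw [Finset.sum_sub_distrib, ← Finset.sum_mul, sq]

lemma sum_triples_eq {n : ℕ} {y : Fin n → ℝ} (hy : ∀ i, y i ^ 2 = y i) :
    ∑ i, ∑ j, ∑ k, (if i ≠ j ∧ j ≠ k ∧ i ≠ k then y i * y j * y k else 0)
      = (∑ i, y i) ^ 3 - 3 * (∑ i, y i) ^ 2 + 2 * ∑ i, y i := by
  have h1 : ∀ i j, ∑ k, (if i ≠ j ∧ j ≠ k ∧ i ≠ k then y i * y j * y k else 0)
      = (if i ≠ j then y i * y j else 0) * (∑ k, y k - 2) := by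
    intro i j
    by_cases hij : i = j
    · simp [hij]
    have h2 : ∀ k, (if i ≠ j ∧ j ≠ k ∧ i ≠ k then y i * y j * y k else 0)
        = y i * y j * y k - (if j = k then y i * y j else 0) - if i = k then y i * y j else 0 := by
      intro k
      by_cases hjk : j = k
      · subst hjk
        simp [hij, mul_assoc, ← sq, hy]
      · by_cases hik : i = k
        · subst hik
          have : y i * y j * y i = y i * y j := by
            rw [mul_right_comm, ← sq, hy]
          simp [hjk, this]
        · simp [hij, hjk, hik]
    simp_rw [h2]
    rw [Finset.sum_sub_distrib, Finset.sum_sub_distrib, ← Finset.mul_sum]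
    simp only [Finset.sum_ite_eq, Finset.mem_univ, if_true, ne_eq, hij, not_false_eq_true]
    ring
  simp_rw [h1, ← Finset.sum_mul]
  rw [sum_pairs_eq hy]
  ring

lemma vertexHamiltonian_eq (β₁ β₂ p : ℝ) (n : ℕ) (x : Fin n → Fin 2) :
    vertexHamiltonian β₁ β₂ p n x = vertexPolynomial β₁ β₂ p n (∑ i, ((x i).val : ℝ)) := by
  rw [vertexHamiltonian, vertexPolynomial, sum_pairs_eq (fun i => sq_fin_two (x i)),
    sum_triples_eq (fun i => sq_fin_two (x i))]

/-- The fraction of occupied sites other than `i`. -/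
noncomputable def otherFraction {n : ℕ} (i : Fin n) (x : Fin n → Fin 2) : ℝ :=
  (∑ j ∈ Finset.univ.erase i, ((x j).val : ℝ)) / n

lemma val_fin_two_mem (a : Fin 2) : (0 : ℝ) ≤ a.val ∧ (a.val : ℝ) ≤ 1 := by
  fin_cases a <;> simp

lemma otherFraction_mem {n : ℕ} (i : Fin n) (x : Fin n → Fin 2) :
    otherFraction i x ∈ Set.Icc (0 : ℝ) 1 := by
  have hn : (0 : ℝ) < n := by exact_mod_cast i.pos
  refine ⟨div_nonneg (Finset.sum_nonneg fun j _ => (val_fin_two_mem _).1) hn.le, ?_⟩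
  rw [otherFraction, div_le_one hn]
  calc _ ≤ ∑ j ∈ Finset.univ.erase i, (1 : ℝ) := Finset.sum_le_sum fun j _ => (val_fin_two_mem _).2
    _ ≤ ∑ j : Fin n, (1 : ℝ) := Finset.sum_le_sum_of_subset_of_nonneg (Finset.erase_subset _ _)
        fun _ _ _ => zero_le_one
    _ = n := by simp

lemma abs_otherFraction_update_sub_le {n : ℕ} (i j : Fin n) (x : Fin n → Fin 2) (c : Fin 2) :
    |otherFraction i (Function.update x j c) - otherFraction i x| ≤ 1 / n := by
  have hn : (0 : ℝ) < n := by exact_mod_cast i.pos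
  rw [otherFraction, otherFraction, ← sub_div, abs_div, abs_of_pos hn]
  refine div_le_div_of_nonneg_right ?_ hn.le
  rw [← Finset.sum_sub_distrib]
  have h1 : ∀ l, ((Function.update x j c l).val : ℝ) - (x l).val
      = if l = j then (c.val : ℝ) - (x j).val else 0 := by
    intro l
    by_cases h : l = j
    · subst h; simp
    · simp [h]
  simp_rw [h1]
  rw [Finset.sum_ite_eq']
  have h2 := val_fin_two_mem c
  have h3 := val_fin_two_mem (x j)
  split_ifs
  · rw [abs_le]; constructor <;> linarith
  · simp

/-- The cubic term is proportional to s (s - 1) (s - 2), whose difference is 3 s (s - 1) rather than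
3 s²; this leaves a correction of order 1/n to `vertexH`. -/
lemma increment_vertexHamiltonian (β₁ β₂ p : ℝ) (n : ℕ) (i : Fin n) (x : Fin n → Fin 2) :
    increment (vertexHamiltonian β₁ β₂ p n) i x
      = vertexH β₁ β₂ p (otherFraction i x) - 3 * β₂ / n * otherFraction i x := by
  have hn : (n : ℝ) ≠ 0 := by exact_mod_cast i.pos.ne'
  have h1 : ∀ c, ∑ j, ((Function.update x i c j).val : ℝ)
      = ∑ j ∈ Finset.univ.erase i, ((x j).val : ℝ) + c.val := by
    intro c
    rw [← Finset.sum_erase_add _ _ (Finset.mem_univ i), Function.update_self]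
    congr 1
    exact Finset.sum_congr rfl fun j hj => by
      rw [Function.update_of_ne (Finset.ne_of_mem_erase hj)]
  rw [increment, vertexHamiltonian_eq, vertexHamiltonian_eq, h1, h1, vertexPolynomial,
    vertexPolynomial, vertexH, otherFraction]
  simp only [Fin.val_zero, Fin.val_one, Nat.cast_zero, Nat.cast_one]
  field_simp
  ring

lemma vertexPhi_eq (β₁ β₂ p x : ℝ) :
    vertexPhi β₁ β₂ p x = Real.sigmoid (vertexH β₁ β₂ p x) := by
  rw [vertexPhi, Real.sigmoid_def, Real.exp_neg]
  have := Real.exp_pos (vertexH β₁ β₂ p x)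
  field_simp
  ring

lemma hasDerivAt_sigmoid_vertexH_sub (β₁ β₂ p t u : ℝ) :
    HasDerivAt (fun u => Real.sigmoid (vertexH β₁ β₂ p u - t * u))
      (Real.sigmoid (vertexH β₁ β₂ p u - t * u) * (1 - Real.sigmoid (vertexH β₁ β₂ p u - t * u))
        * (2 * β₁ + 6 * β₂ * u - t)) u := by
  have h1 : HasDerivAt (fun u => vertexH β₁ β₂ p u - t * u) (2 * β₁ + 6 * β₂ * u - t) u := by
    unfold vertexH
    have := ((((hasDerivAt_id u).const_mul (2 * β₁)).add
      ((hasDerivAt_pow 2 u).const_mul (3 * β₂))).add_const (Real.log (p / (1 - p)))).sub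
      ((hasDerivAt_id u).const_mul t)
    exact this.congr_deriv (by simp; ring)
  exact (Real.hasDerivAt_sigmoid _).comp u h1

lemma abs_sigmoid_mul_one_sub_sub_le (a b : ℝ) :
    |Real.sigmoid a * (1 - Real.sigmoid a) - Real.sigmoid b * (1 - Real.sigmoid b)| ≤ |a - b| := by
  have h1 : Real.sigmoid a * (1 - Real.sigmoid a) - Real.sigmoid b * (1 - Real.sigmoid b)
      = (Real.sigmoid a - Real.sigmoid b) * (1 - Real.sigmoid a - Real.sigmoid b) := by ring
  have h2 : |1 - Real.sigmoid a - Real.sigmoid b| ≤ 1 := by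
    rw [abs_le]
    constructor <;> linarith [Real.sigmoid_pos a, Real.sigmoid_pos b, Real.sigmoid_lt_one a,
      Real.sigmoid_lt_one b]
  rw [h1, abs_mul]
  have h3 := abs_sigmoid_sub_le a b
  calc _ ≤ |Real.sigmoid a - Real.sigmoid b| * 1 := mul_le_mul_of_nonneg_left h2 (abs_nonneg _)
    _ ≤ |a - b| := by linarith [abs_nonneg (a - b)]

/-- The slope of `φ_β` bounds the slope of its perturbations up to a small error. -/
lemma abs_sigmoid_vertexH_sub_le {β₁ β₂ p α : ℝ}
    (hα : ∀ u ∈ Set.Ioo (0 : ℝ) 1, |deriv (vertexPhi β₁ β₂ p) u| ≤ α) {t u v : ℝ}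
    (hu : u ∈ Set.Icc (0 : ℝ) 1) (hv : v ∈ Set.Icc (0 : ℝ) 1) :
    |Real.sigmoid (vertexH β₁ β₂ p u - t * u) - Real.sigmoid (vertexH β₁ β₂ p v - t * v)|
      ≤ (α + |t| * (1 + 2 * |β₁| + 6 * |β₂|)) * |u - v| := by
  wlog huv : v < u generalizing u v
  · rcases (not_lt.1 huv).eq_or_lt with h | h
    · simp [h]
    · rw [abs_sub_comm, abs_sub_comm u]
      exact this hv hu h
  set ψ : ℝ → ℝ := fun u => Real.sigmoid (vertexH β₁ β₂ p u - t * u)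
  obtain ⟨w, hw, hslope⟩ := exists_hasDerivAt_eq_slope ψ _ huv
    (fun z _ => (hasDerivAt_sigmoid_vertexH_sub β₁ β₂ p t z).continuousAt.continuousWithinAt)
    (fun z _ => hasDerivAt_sigmoid_vertexH_sub β₁ β₂ p t z)
  have hw01 : w ∈ Set.Ioo (0 : ℝ) 1 := ⟨hv.1.trans_lt hw.1, hw.2.trans_le hu.2⟩
  have hφ : deriv (vertexPhi β₁ β₂ p) w = Real.sigmoid (vertexH β₁ β₂ p w)
      * (1 - Real.sigmoid (vertexH β₁ β₂ p w)) * (2 * β₁ + 6 * β₂ * w) := by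
    have h1 := hasDerivAt_sigmoid_vertexH_sub β₁ β₂ p 0 w
    simp only [zero_mul, sub_zero] at h1
    rw [← h1.deriv]
    congr 1
    exact funext fun z => vertexPhi_eq β₁ β₂ p z
  have hφα := hα w hw01
  rw [hφ] at hφα
  set a := Real.sigmoid (vertexH β₁ β₂ p w - t * w)
    * (1 - Real.sigmoid (vertexH β₁ β₂ p w - t * w)) with ha
  set b := Real.sigmoid (vertexH β₁ β₂ p w) * (1 - Real.sigmoid (vertexH β₁ β₂ p w)) with hb
  have hab : |a - b| ≤ |t| := by
    refine (abs_sigmoid_mul_one_sub_sub_le _ _).trans ?_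
    rw [sub_sub_cancel_left, abs_neg, abs_mul, abs_of_pos hw01.1]
    exact mul_le_of_le_one_right (abs_nonneg _) hw01.2.le
  have ha1 : |a| ≤ 1 := by
    have := sigmoid_mul_one_sub_mem (vertexH β₁ β₂ p w - t * w)
    rw [abs_of_nonneg this.1]
    linarith [this.2]
  have hh : |2 * β₁ + 6 * β₂ * w| ≤ 2 * |β₁| + 6 * |β₂| := by
    refine (abs_add_le _ _).trans ?_
    rw [abs_mul, abs_mul, abs_mul, abs_of_pos hw01.1, abs_two, abs_of_pos (by norm_num : (0:ℝ) < 6)]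
    have := mul_le_of_le_one_right (by positivity : 0 ≤ 6 * |β₂|) hw01.2.le
    linarith
  have hbound : |a * (2 * β₁ + 6 * β₂ * w - t)| ≤ α + |t| * (1 + 2 * |β₁| + 6 * |β₂|) := by
    -- The first term is the slope of φ_β at `w`, bounded by `α`; the other two are errors
    -- proportional to `|t|`.
    have h1 : a * (2 * β₁ + 6 * β₂ * w - t)
        = b * (2 * β₁ + 6 * β₂ * w) + (a - b) * (2 * β₁ + 6 * β₂ * w) + -(a * t) := by ring
    rw [h1]
    refine (abs_add_three _ _ _).trans ?_
    rw [abs_neg, abs_mul (a - b), abs_mul a]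
    have h2 := mul_le_mul hab hh (abs_nonneg _) (abs_nonneg _)
    have h3 := mul_le_mul_of_nonneg_right ha1 (abs_nonneg t)
    linarith
  have huv' : 0 < u - v := sub_pos.2 huv
  rw [eq_div_iff huv'.ne'] at hslope
  change |ψ u - ψ v| ≤ _
  rw [← hslope, abs_mul]
  exact mul_le_mul_of_nonneg_right hbound (abs_nonneg _)

/-- The real `sSup` of an unbounded set is 0 by convention, so boundedness is needed before the
hypothesis on the supremum controls individual slopes. -/
lemma bddAbove_abs_deriv_vertexPhi (β₁ β₂ p : ℝ) :
    BddAbove ((fun x => |deriv (vertexPhi β₁ β₂ p) x|) '' Set.Ioo (0 : ℝ) 1) := by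
  refine ⟨2 * |β₁| + 6 * |β₂|, ?_⟩
  rintro _ ⟨w, hw, rfl⟩
  have h1 := hasDerivAt_sigmoid_vertexH_sub β₁ β₂ p 0 w
  simp only [zero_mul, sub_zero] at h1
  have h2 : vertexPhi β₁ β₂ p = fun z => Real.sigmoid (vertexH β₁ β₂ p z) :=
    funext fun z => vertexPhi_eq β₁ β₂ p z
  have h3 := sigmoid_mul_one_sub_mem (vertexH β₁ β₂ p w)
  dsimp only
  rw [h2, h1.deriv, abs_mul, abs_of_nonneg h3.1]
  have hh : |2 * β₁ + 6 * β₂ * w| ≤ 2 * |β₁| + 6 * |β₂| := by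
    refine (abs_add_le _ _).trans ?_
    rw [abs_mul, abs_mul, abs_mul, abs_of_pos hw.1, abs_two, abs_of_pos (by norm_num : (0:ℝ) < 6)]
    have := mul_le_of_le_one_right (by positivity : 0 ≤ 6 * |β₂|) hw.2.le
    linarith
  exact (mul_le_of_le_one_left (abs_nonneg _) (by linarith [h3.2])).trans hh

theorem exists_satisfiesLSI_vertexERGM (β₁ β₂ p : ℝ)
    (h : sSup ((fun x => |deriv (vertexPhi β₁ β₂ p) x|) '' Set.Ioo (0 : ℝ) 1) < 1) :
    ∃ σ2 : ℝ, 0 < σ2 ∧ ∀ n : ℕ, SatisfiesLSI (vertexERGM β₁ β₂ p n) σ2 := by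
  set α₀ := sSup ((fun x => |deriv (vertexPhi β₁ β₂ p) x|) '' Set.Ioo (0 : ℝ) 1)
  have hα₀ : 0 ≤ α₀ := Real.sSup_nonneg (by rintro _ ⟨x, -, rfl⟩; exact abs_nonneg _)
  have hle : ∀ u ∈ Set.Ioo (0 : ℝ) 1, |deriv (vertexPhi β₁ β₂ p) u| ≤ α₀ := fun u hu =>
    le_csSup (bddAbove_abs_deriv_vertexPhi β₁ β₂ p) ⟨u, hu, rfl⟩
  set D : ℝ := 3 * |β₂| * (1 + 2 * |β₁| + 6 * |β₂|)
  -- From `n₀` on, the error `D / n` uses at most half of the gap `1 - α₀`, which leaves the slope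
  -- bound `α = (α₀ + 1) / 2 < 1`.
  obtain ⟨n₀, hn₀⟩ := exists_nat_gt (D / ((1 - α₀) / 2))
  set α : ℝ := (α₀ + 1) / 2 with hαdef
  have hα : α < 1 := by rw [hαdef]; linarith
  set M : ℝ := 2 * |β₁| + 6 * |β₂| + |Real.log (p / (1 - p))|
  set σ : ℝ := 2 / (Real.sigmoid (-M) * (1 - α) ^ 2)
  have hσ : 0 < σ :=
    div_pos two_pos (mul_pos (Real.sigmoid_pos _) (pow_pos (sub_pos.2 hα) 2))
  choose τ hτ0 hτ using fun n => exists_satisfiesLSI_gibbs (vertexHamiltonian β₁ β₂ p n)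
  -- One constant for all `n`: `σ` serves large `n`, and the sum dominates each constant `τ n` with
  -- `n < n₀`.
  refine ⟨σ + ∑ n ∈ Finset.range n₀, τ n,
    add_pos_of_pos_of_nonneg hσ (Finset.sum_nonneg fun n _ => (hτ0 n).le), fun n => ?_⟩
  rcases lt_or_ge n n₀ with hn | hn
  · refine (hτ n).mono ?_
    have := Finset.single_le_sum (f := τ) (fun n _ => (hτ0 n).le) (Finset.mem_range.2 hn)
    linarith
  refine SatisfiesLSI.mono ?_
    (le_add_of_nonneg_right (Finset.sum_nonneg fun n _ => (hτ0 n).le))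
  refine satisfiesLSI_gibbs_of_increment _ hα (A := fun _ _ => α / n)
    (fun _ _ => div_nonneg (by rw [hαdef]; linarith) (Nat.cast_nonneg n)) (fun _ _ => rfl)
    (fun i => ?_) (fun i j x c _ => ?_) (fun i x => ?_)
  · have hnpos : (n : ℝ) ≠ 0 := by exact_mod_cast i.pos.ne'
    rw [Finset.sum_const, Finset.card_univ, Fintype.card_fin, nsmul_eq_mul,
      mul_div_cancel₀ _ hnpos]
  · have hnpos : (0 : ℝ) < n := by exact_mod_cast i.pos
    rw [increment_vertexHamiltonian, increment_vertexHamiltonian]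
    refine (abs_sigmoid_vertexH_sub_le hle (otherFraction_mem i _) (otherFraction_mem i x)).trans ?_
    have h1 : α₀ + |3 * β₂ / n| * (1 + 2 * |β₁| + 6 * |β₂|) ≤ α := by
      have h2 : |3 * β₂ / n| * (1 + 2 * |β₁| + 6 * |β₂|) = D / n := by
        rw [abs_div, abs_mul, abs_of_pos hnpos, abs_of_pos (by norm_num : (0:ℝ) < 3)]
        ring
      have h3 : D / n ≤ (1 - α₀) / 2 := by
        rw [div_le_iff₀ hnpos]
        rw [div_lt_iff₀ (by linarith)] at hn₀
        have h4 : (n₀ : ℝ) ≤ n := by exact_mod_cast hn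
        have h5 := mul_le_mul_of_nonneg_right h4 (by linarith : 0 ≤ (1 - α₀) / 2)
        linarith
      rw [h2, hαdef]
      linarith
    calc _ ≤ α * (1 / n) := mul_le_mul h1 (abs_otherFraction_update_sub_le i j x c)
          (abs_nonneg _) (by rw [hαdef]; linarith)
      _ = α / n := by ring
  · have hnpos : (1 : ℝ) ≤ n := by exact_mod_cast i.pos
    have hu := otherFraction_mem i x
    rw [increment_vertexHamiltonian, vertexH]
    set u := otherFraction i x
    have h1 : |2 * β₁ * u| ≤ 2 * |β₁| := by
      rw [abs_mul, abs_mul, abs_two, abs_of_nonneg hu.1]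
      exact mul_le_of_le_one_right (by positivity) hu.2
    have h2 : |3 * β₂ * u ^ 2| ≤ 3 * |β₂| := by
      rw [abs_mul, abs_mul, abs_of_pos (by norm_num : (0:ℝ) < 3), abs_of_nonneg (sq_nonneg u)]
      exact mul_le_of_le_one_right (by positivity) (pow_le_one₀ hu.1 hu.2)
    have h3 : |3 * β₂ / n * u| ≤ 3 * |β₂| := by
      rw [abs_mul, abs_div, abs_mul, abs_of_pos (by norm_num : (0:ℝ) < 3), abs_of_nonneg hu.1,
        abs_of_pos (by linarith : (0 : ℝ) < n)]
      exact (mul_le_of_le_one_right (by positivity) hu.2).trans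
        (div_le_self (by positivity) hnpos)
    calc _ ≤ |2 * β₁ * u| + |3 * β₂ * u ^ 2| + |Real.log (p / (1 - p))| + |3 * β₂ / n * u| :=
          (abs_sub _ _).trans (add_le_add_left (abs_add_three _ _ _) _)
      _ ≤ M := by linarith

end VertexERGM

theorem theorem3p1 :
    -- exponential random graph models
    (∀ (s : ℕ) (v : Fin s → ℕ) (G : (i : Fin s) → SimpleGraph (Fin (v i))) (β : Fin s → ℝ),
      (∀ i, (G i).Connected) →
      1 / 2 * deriv (ergmPhi G (fun i => |β i|)) 1 < 1 →
      ∃ σ2 : ℝ, 0 < σ2 ∧ ∀ n : ℕ, SatisfiesLSI (ergm G β n) σ2) ∧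
    -- vertex-weighted exponential random graph models
    (∀ β₁ β₂ p : ℝ, 0 < p → p < 1 →
      sSup ((fun x => |deriv (vertexPhi β₁ β₂ p) x|) '' Set.Ioo (0 : ℝ) 1) < 1 →
      ∃ σ2 : ℝ, 0 < σ2 ∧ ∀ n : ℕ, SatisfiesLSI (vertexERGM β₁ β₂ p n) σ2) ∧
    -- random colorings
    (∀ Δ k : ℕ, 2 * Δ + 1 ≤ k →
      ∃ σ2 : ℝ, 0 < σ2 ∧
        ∀ (V : Type*) [Fintype V] [DecidableEq V] (G : SimpleGraph V) [DecidableRel G.Adj],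
          G.maxDegree ≤ Δ → SatisfiesLSI (randomColoring G k) σ2) ∧
    -- hard-core models
    (∀ (Δ : ℕ) (lam : ℝ), 0 ≤ lam → lam * ((Δ : ℝ) - 1) < 1 →
      ∃ σ2 : ℝ, 0 < σ2 ∧
        ∀ (V : Type*) [Fintype V] [DecidableEq V] (G : SimpleGraph V) [DecidableRel G.Adj],
          G.maxDegree ≤ Δ → SatisfiesLSI (hardCore G lam) σ2) :=
  ⟨fun _ _ G β _ h => exists_satisfiesLSI_ergm G β h,
    fun β₁ β₂ p _ _ h => exists_satisfiesLSI_vertexERGM β₁ β₂ p h,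
    exists_satisfiesLSI_randomColoring, exists_satisfiesLSI_hardCore⟩
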